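/- \textbf{Theorem (Predictivity of effective field theories).} Consider a scalar field theory in four Euclidean dimensions. Let $K$ be a smooth cutoff function with $K=1$ on $[0,1]$ and $K=0$ on $[4,\infty)$, let $0<\Lambda_R\le\Lambda_0$, let $A,B$ be real with $|A|\le\Lambda_R^3$, $|B|\le\Lambda_R^2$, and put $\Delta_\Lambda(k)=K(k^2/\Lambda^2)/(k^2+B)$. The vertex functions $L_n(k_1,\dots,k_n,\Lambda)$, $n\ge1$, $\sum_i k_i=0$, are formal power series $$L_n=\sum_{r_1,\dots,r_5\ge0}(\rho_4^R)^{r_1}(\rho_5^R)^{r_2}(\rho_6^0)^{r_3}(\rho_7^0)^{r_4}(\rho_8^0)^{r_5}\,L_n^{(r_1,\dots,r_5)}$$ (generalized perturbation theory; only the coefficients $L_n^{(r)}$, $r=(r_1,\dots,r_5)$, enter below, and no normalization of the bare couplings at $\Lambda_0$ is required). The coefficients are real, smooth, permutation symmetric and $O(4)$-invariant, vanish for $r=0$, and satisfy $L_n^{(r)}=0$ for $n>N(r)$ with a fixed function $N$. For $\Lambda_R\le\Lambda\le\Lambda_0$ they solve, order by order, together with all momentum derivatives, Polchinski's equation $$\frac{d}{d\Lambda}L_n(k_1,\dots,k_n)=-\frac12\sum_{S\subseteq\{1,\dots,n\}}\frac{d\Delta_\Lambda}{d\Lambda}(k_S)\,L_{|S|+1}\big((k_i)_{i\in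 S},-k_S\big)\,L_{n-|S|+1}\big((k_i)_{i\notin S},k_S\big)$$ $$\qquad-\frac12\int\frac{d^4k}{(2\pi)^4}\,L_{n+2}(k_1,\dots,k_n,k,-k)\,\frac{d\Delta_\Lambda}{d\Lambda}(k)-\frac12A\,L_{n+1}(k_1,\dots,k_n,0)\,\frac{d\Delta_\Lambda}{d\Lambda}(0),\qquad k_S=\sum_{i\in S}k_i .$$ Let $r_{NR}=r_3+r_4+r_5$ and $A_n^{(r)}=\Lambda^{n-4+r_1-r_{NR}}L_n^{(r)}$. Let $\partial^p$ stand for any product of $p$ derivatives $\partial^\mu_{i,j}=\partial/\partial k_i^\mu-\partial/\partial k_j^\mu$, and let $\|f(\Lambda)\|$ be the maximum of $|f|$ over all $k_1,\dots,k_n$ with $\sum_ik_i=0$ and $k_i^2\le4\Lambda^2$. $Pln(z)$ denotes a polynomial in $\ln z$ with nonnegative coefficients, which may be different at each occurrence and for each $(n,p,r)$. Consider a family of such solutions $L_n^{(r)}(\Lambda,t)$, $t\in[0,1]$ (with the same $K,A,B,\Lambda_R,\Lambda_0,N$), with the following properties. (a) Renormalization conditions at $\Lambda_R$, for all $t$: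 $L_1(0)=0$, $L_2(0)=0$, $\partial^\mu_{1,2}\partial^\nu_{1,2}L_2(0)=0$, $L_3(0)=\rho_4^R$, $L_4(0)=\rho_5^R$, as identities of formal power series. (b) Improvement conditions of index $s=1$ at $\Lambda_R$: $\partial^\mu_{i,3}\partial^\nu_{i,3}L_3(0)=\rho_6^{NR}\delta^{\mu\nu}$ $(i=1,2)$, $\partial^\mu_{i,3}\partial^\nu_{j,3}L_3(0)=\rho_7^{NR}\delta^{\mu\nu}$ $(i\ne j\in\{1,2\})$, $L_5(0)=\rho_8^{NR}$, with formal power series $\rho_6^{NR},\rho_7^{NR},\rho_8^{NR}$ that do not depend on $t$. (c) The bare vertex functions are rescaled by $t$: $\partial^pA_n^{(r)}(\Lambda_0,t)=t\,\partial^pA_n^{(r)}(\Lambda_0,1)$ for $n+p\ge6$. (d) $\|\partial^pA_n^{(r)}(\Lambda,t)\|\le\Lambda^{-p}\left(\frac{\Lambda}{\Lambda_R}\right)^{r_1}\left(\frac{\Lambda_0}{\Lambda}\right)^{r_{NR}}Pln\left(\frac{\Lambda_0}{\Lambda_R}\right)$ for all $n\ge1$, $p$, $r$, $t\in[0,1]$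 and $\Lambda_R\le\Lambda\le\Lambda_0$. (e) $\|\frac{d}{dt}\partial^pA_n^{(r)}(\Lambda_0,t)\|\le\Lambda_0^{-p}\left(\frac{\Lambda_0}{\Lambda_R}\right)^{r_1}Pln\left(\frac{\Lambda_0}{\Lambda_R}\right)$ for $n+p\ge6$, all $r$ and $t\in[0,1]$. Then for all $n\ge1$, $p$, $r$, $t\in[0,1]$ and $\Lambda_R\le\Lambda\le\Lambda_0$ the derivative $\frac{d}{dt}\partial^pA_n^{(r)}(\Lambda,t)$ exists and $$\Big\|\frac{d}{dt}\partial^pA_n^{(r)}(\Lambda,t)\Big\|\le\Lambda^{-p}\left(\frac{\Lambda}{\Lambda_R}\right)^{r_1}\left(\frac{\Lambda_0}{\Lambda}\right)^{r_{NR}}\left(\frac{\Lambda}{\Lambda_0}\right)^{2}Pln\left(\frac{\Lambda_0}{\Lambda_R}\right),$$ and $\|\partial^pA_n^{(r)}(\Lambda,1)-\partial^pA_n^{(r)}(\Lambda,0)\|$ satisfies the same bound. The polynomials in the conclusion depend only on $(n,p,r)$, on $K$ and $N$, and on the polynomials in (d) and (e); they do not depend on $\Lambda_R,\Lambda_0,\Lambda,t,A,B$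 or on the family. -/

import Mathlib

open scoped ContDiff

noncomputable section

namespace PolchinskiFlow

/-- Euclidean momentum space in four dimensions. -/
abbrev Mom : Type := EuclideanSpace ℝ (Fin 4)

/-- Orders `(r₁, …, r₅)` in generalized perturbation theory, i.e. the exponents of
`ρ₄ᴿ, ρ₅ᴿ, ρ₆⁰, ρ₇⁰, ρ₈⁰`. -/
abbrev PertOrder : Type := Fin 5 → ℕ

/-- The overall order `r₃ + r₄ + r₅` in the bare nonrenormalizable couplings. -/
def ordNR (r : PertOrder) : ℕ := r 2 + r 3 + r 4

/-- Expansion coefficients `Lₙ^{(r)}(k₁, …, kₙ)` of the vertex functions at one scale. Vertex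
functions are meaningful for `n ≥ 1` and on the hyperplane `k₁ + ⋯ + kₙ = 0` only: below, they are
only evaluated there and only differentiated in directions tangent to it. -/
abbrev VertexFunctions : Type := (n : ℕ) → PertOrder → (Fin n → Mom) → ℝ

/-- Total momentum zero. -/
def Conserved {n : ℕ} (k : Fin n → Mom) : Prop := ∑ i, k i = 0

/-- The direction of the derivative `∂^μ_{i,j} = ∂/∂kᵢ^μ - ∂/∂kⱼ^μ`. -/
def momDir {n : ℕ} (a : Fin n × Fin n × Fin 4) : Fin n → Mom :=
  Pi.single a.1 (EuclideanSpace.single a.2.2 (1 : ℝ)) -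
    Pi.single a.2.1 (EuclideanSpace.single a.2.2 (1 : ℝ))

/-- The momentum derivative `∂^p = ∂^{μ₁}_{i₁,j₁} ⋯ ∂^{μ_p}_{i_p,j_p}` of `f` at `k`, where
`a m = (iₘ, jₘ, μₘ)`. -/
def momDeriv {n p : ℕ} (a : Fin p → Fin n × Fin n × Fin 4) (f : (Fin n → Mom) → ℝ)
    (k : Fin n → Mom) : ℝ :=
  iteratedFDeriv ℝ p f k (fun m => momDir (a m))

/-- The momenta over which the maximum in the norm `‖·‖` at scale `Λ` is taken. -/
def region (n : ℕ) (Λ : ℝ) : Set (Fin n → Mom) :=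
  {k | Conserved k ∧ ∀ i, ‖k i‖ ^ 2 ≤ 4 * Λ ^ 2}

/-- Smooth cutoff functions: `1` on `[0, 1]` and `0` on `[4, ∞)`. -/
structure IsCutoff (K : ℝ → ℝ) : Prop where
  smooth : ContDiff ℝ ∞ K
  eq_one : ∀ z, 0 ≤ z → z ≤ 1 → K z = 1
  eq_zero : ∀ z, 4 ≤ z → K z = 0

/-- The regularized propagator `K(k²/Λ²) / (k² + B)`. -/
def propagator (K : ℝ → ℝ) (B Λ : ℝ) (q : Mom) : ℝ := K (‖q‖ ^ 2 / Λ ^ 2) / (‖q‖ ^ 2 + B)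

/-- `d/dΛ` of the regularized propagator. -/
def dPropagator (K : ℝ → ℝ) (B Λ : ℝ) (q : Mom) : ℝ := deriv (fun l => propagator K B l q) Λ

/-- The momenta `(k_i)_{i ∈ S}`, in increasing order of `i`, followed by `q`. -/
def subMom {n : ℕ} (S : Finset (Fin n)) (k : Fin n → Mom) (q : Mom) : Fin (S.card + 1) → Mom :=
  Fin.snoc (α := fun _ => Mom) (fun i => k (S.orderEmbOfFin rfl i)) q

/-- The right-hand side of the Polchinski equation for `d/dΛ Lₙ^{(r)}`, that is the coefficient of
order `r` and of degree `n` in the fields in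
`-½ ∫ d⁴k (2π)⁴ (dΔ_Λ/dΛ) (δL/δφ(k) δL/δφ(-k) + δ²L/δφ(k)δφ(-k) + A δ(k) δL/δφ(k))`.
The sum over `S` distributes the external momenta over the two factors in all possible ways. -/
def polchinskiRHS (K : ℝ → ℝ) (A B Λ : ℝ) (L : VertexFunctions) (n : ℕ) (r : PertOrder)
    (k : Fin n → Mom) : ℝ :=
  - (1 / 2) * (∑ S : Finset (Fin n), ∑ s ∈ Finset.Iic r,
      dPropagator K B Λ (∑ i ∈ S, k i) *
        L (S.card + 1) s (subMom S k (-∑ i ∈ S, k i)) *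
        L (Sᶜ.card + 1) (r - s) (subMom Sᶜ k (∑ i ∈ S, k i)))
  - (1 / 2) * (1 / (2 * Real.pi) ^ 4) * (∫ q : Mom,
      L (n + 2) r (Fin.snoc (α := fun _ => Mom) (Fin.snoc (α := fun _ => Mom) k q) (-q)) *
        dPropagator K B Λ q)
  - (1 / 2) * A * L (n + 1) r (Fin.snoc (α := fun _ => Mom) k 0) * dPropagator K B Λ 0

/-- `Λ ↦ L Λ` is, order by order in generalized perturbation theory, a solution on `[ΛR, Λ0]` of the
Polchinski equation and of the equations for the momentum derivatives. The vertex functions are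
smooth, symmetric and `O(4)`-invariant, vanish to order zero, and to any given order `r` only finitely
many of them (those with `n ≤ N r`) are nonzero. -/
structure IsFlow (K : ℝ → ℝ) (N : PertOrder → ℕ) (A B ΛR Λ0 : ℝ) (L : ℝ → VertexFunctions) : Prop where
  smooth : ∀ Λ ∈ Set.Icc ΛR Λ0, ∀ n r, 1 ≤ n → ContDiff ℝ ∞ (L Λ n r)
  symmetric : ∀ Λ ∈ Set.Icc ΛR Λ0, ∀ n r, 1 ≤ n → ∀ (σ : Equiv.Perm (Fin n)) (k : Fin n → Mom),
    Conserved k → L Λ n r (fun i => k (σ i)) = L Λ n r k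
  invariant : ∀ Λ ∈ Set.Icc ΛR Λ0, ∀ n r, 1 ≤ n → ∀ (G : Mom ≃ₗᵢ[ℝ] Mom) (k : Fin n → Mom),
    Conserved k → L Λ n r (fun i => G (k i)) = L Λ n r k
  order_zero : ∀ Λ ∈ Set.Icc ΛR Λ0, ∀ n, 1 ≤ n → ∀ k, Conserved k → L Λ n 0 k = 0
  finite_order : ∀ Λ ∈ Set.Icc ΛR Λ0, ∀ n r, 1 ≤ n → N r < n → ∀ k, Conserved k → L Λ n r k = 0
  rge : ∀ Λ ∈ Set.Icc ΛR Λ0, ∀ n r, 1 ≤ n →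
    ∀ (p : ℕ) (a : Fin p → Fin n × Fin n × Fin 4) (k : Fin n → Mom), Conserved k →
      HasDerivWithinAt (fun l => momDeriv a (L l n r) k)
        (momDeriv a (polchinskiRHS K A B Λ (L Λ) n r) k) (Set.Icc ΛR Λ0) Λ

/-- The Kronecker symbol `δ^{μν}`. -/
def kron (μ ν : Fin 4) : ℝ := if μ = ν then 1 else 0

/-- The renormalization conditions `ρ₁ = ρ₂ = ρ₃ = 0`, `ρ₄ = ρ₄ᴿ`, `ρ₅ = ρ₅ᴿ`, order by order, for
the vertex functions `L` at the renormalization scale. -/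
structure RenormalizationConditions (L : VertexFunctions) : Prop where
  rho₁ : ∀ r, L 1 r 0 = 0
  rho₂ : ∀ r, L 2 r 0 = 0
  rho₃ : ∀ r μ ν, momDeriv ![(0, 1, μ), (0, 1, ν)] (L 2 r) 0 = 0
  rho₄ : ∀ r, L 3 r 0 = if r = ![1, 0, 0, 0, 0] then 1 else 0
  rho₅ : ∀ r, L 4 r 0 = if r = ![0, 1, 0, 0, 0] then 1 else 0

/-- The improvement conditions of index `s = 1`, order by order: at the renormalization scale, the
couplings `ρ₆, ρ₇, ρ₈` defined by `ρ₆ δ^{μν} = ∂^μ_{i,3} ∂^ν_{i,3} L₃(0)` for `i = 1, 2`,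
`ρ₇ δ^{μν} = ∂^μ_{i,3} ∂^ν_{j,3} L₃(0)` for `i ≠ j` in `{1, 2}` and `ρ₈ = L₅(0)` have the prescribed
values. -/
structure ImprovementConditions (ρ₆ ρ₇ ρ₈ : PertOrder → ℝ) (L : VertexFunctions) : Prop where
  rho₆ : ∀ r μ ν, ∀ i : Fin 3, i ≠ 2 →
    momDeriv ![(i, 2, μ), (i, 2, ν)] (L 3 r) 0 = ρ₆ r * kron μ ν
  rho₇ : ∀ r μ ν, ∀ i j : Fin 3, i ≠ 2 → j ≠ 2 → i ≠ j →
    momDeriv ![(i, 2, μ), (j, 2, ν)] (L 3 r) 0 = ρ₇ r * kron μ ν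
  rho₈ : ∀ r, L 5 r 0 = ρ₈ r

/-- The dimensionless coefficients
`Aₙ^{(r)}(Λ) = Λ^{n - 4 + r₁ - (r₃ + r₄ + r₅)} Lₙ^{(r)}(Λ)`. -/
def dimless (Λ : ℝ) (L : VertexFunctions) : VertexFunctions := fun n r k =>
  Λ ^ ((n : ℤ) - 4 + (r 0 : ℤ) - (ordNR r : ℤ)) * L n r k

/-- The polynomials allowed as `Pln`: nonnegative coefficients. -/
def IsPln (P : Polynomial ℝ) : Prop := ∀ i, 0 ≤ P.coeff i

/-- `Λ^{-p} (Λ/ΛR)^{r₁} (Λ0/Λ)^{r_NR} P(ln (Λ0/ΛR))`. -/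
def powerBound (ΛR Λ0 Λ : ℝ) (p : ℕ) (r : PertOrder) (P : Polynomial ℝ) : ℝ :=
  (Λ ^ p)⁻¹ * (Λ / ΛR) ^ (r 0) * (Λ0 / Λ) ^ (ordNR r) * P.eval (Real.log (Λ0 / ΛR))

end PolchinskiFlow

end

open PolchinskiFlow

/-!
The theorem says that two flows that agree at `ΛR` in all couplings with `n + p ≤ 5`, and differ at `Λ0`
only in the irrelevant ones, differ at scale `Λ` by a factor `(Λ / Λ0) ^ 2` less than their size.

In terms of `L` instead of `A`, the bounds read `|∂^p Lₙ^{(r)}| ≤ M_r Λ^{4 - n - p} Pln`, where the factor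
`M_r = ΛR^{-r₁} Λ0^{r_NR}` (`orderScale`) does not depend on `Λ` and is multiplicative in `r`; the claim
is that differences are bounded by `M_r Λ0⁻² Λ^{6 - n - p} Pln`. No `t`-derivative is estimated directly:

* *Differences.* `differenceBound` bounds `L t - L t'` by induction on `r` and, at fixed `r`, downwards
  in `n` (`order_induction`). As the coefficients of order `0` vanish, the tree terms of the flow equation
  involve strictly lower orders only, and the loop term involves `n + 2` legs; so the right-hand side
  is controlled by the induction hypothesis (`rhs_difference_bound`, based on the power counting of
  `scaleBound_treeTerm` and `scaleBound_loopTerm`). The flow is then integrated (`flow_estimate`). For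
  `n + p ≥ 6` one starts from the bare scale, where the difference is linear in `t - t'`; the
  integral costs one logarithm. For `n + p ≤ 5` one starts from `ΛR` at zero momentum, where the
  renormalization and improvement conditions and `O(4)`-invariance make the difference vanish
  (`momDeriv_zero_eq_of_conditions`); other momenta are reached by the mean value inequality from
  derivatives of order `p + 1`.
* *Polynomial dependence on `t`.* By the same induction, each coefficient of order `r` is a polynomial in
  `t` of degree at most `r₁ + ⋯ + r₅` (`IsBoundedFamily.polyOn`): a finite combination of evaluations in
  `t` that annihilates such polynomials satisfies a flow equation with zero right-hand side
  and zero boundary values. Hence `t`-derivatives exist, and they are bounded by the oscillation in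
  `t` (`exists_derivative_bound`).

Two points need care. The differentiated propagator must be bounded uniformly in `B`, including
`B = -Λ²`, where its denominator vanishes on the boundary of the support of its numerator; the numerator
is flat there (`dPropagator_bound`). And vertex functions are meaningful on the hyperplane of conserved
momenta only, so they are replaced by their extensions that are constant in the transversal direction
(`hyperplaneExt`), all of whose derivatives are controlled by the admissible ones.
-/

noncomputable section

namespace PolchinskiFlow

/-! ### Dividing flat functions by a vanishing denominator -/

/-- Smooth functions on the line that are supported in `[0, 3]`; in particular they are flat
at `0`. -/
structure IsFlat (f : ℝ → ℝ) : Prop where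
  smooth : ContDiff ℝ ∞ f
  nonpos : ∀ y ≤ 0, f y = 0
  large : ∀ y, 3 < y → f y = 0

theorem IsFlat.isFlat_deriv {f : ℝ → ℝ} (hf : IsFlat f) : IsFlat (deriv f) where
  smooth := (contDiff_infty_iff_deriv.1 hf.smooth).2
  nonpos y hy := by
    have h1 : HasDerivWithinAt f (deriv f y) (Set.Iic 0) y :=
      ((hf.smooth.differentiable (by simp)) y).hasDerivAt.hasDerivWithinAt
    have h2 : HasDerivWithinAt f 0 (Set.Iic 0) y :=
      (hasDerivWithinAt_const y (Set.Iic 0) (0 : ℝ)).congr (fun z hz => hf.nonpos z hz)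
        (hf.nonpos y hy)
    exact (uniqueDiffOn_Iic (0 : ℝ) y hy).eq_deriv _ h1 h2
  large y hy := by
    have : f =ᶠ[nhds y] fun _ => 0 := by
      filter_upwards [lt_mem_nhds hy] with z hz using hf.large z hz
    rw [this.deriv_eq]; simp

theorem IsFlat.abs_le_mul_pow (m : ℕ) : ∀ {f : ℝ → ℝ}, IsFlat f →
    ∃ C, 0 ≤ C ∧ ∀ y, 0 ≤ y → |f y| ≤ C * y ^ m := by
  induction m with
  | zero =>
    intro f hf
    obtain ⟨C, hC⟩ := isCompact_Icc.exists_bound_of_continuousOn (s := Set.Icc (0 : ℝ) 3)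
      hf.smooth.continuous.continuousOn
    refine ⟨max C 0, le_max_right _ _, fun y hy => ?_⟩
    by_cases h : y ≤ 3
    · simpa using Or.inl (hC y ⟨hy, h⟩)
    · rw [hf.large y (not_le.1 h)]; simp
  | succ m ih =>
    intro f hf
    obtain ⟨C, hC0, hC⟩ := ih hf.isFlat_deriv
    refine ⟨C, hC0, fun y hy => ?_⟩
    have := (convex_Icc (0 : ℝ) y).norm_image_sub_le_of_norm_deriv_le (f := f) (C := C * y ^ m)
      (fun x _ => (hf.smooth.differentiable (by simp)) x)
      (fun x hx => (hC x hx.1).trans (by gcongr; exacts [hx.1, hx.2]))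
      (Set.left_mem_Icc.2 hy) (Set.right_mem_Icc.2 hy)
    rw [hf.nonpos 0 le_rfl, sub_zero, sub_zero, Real.norm_eq_abs, Real.norm_eq_abs,
      abs_of_nonneg hy] at this
    rwa [pow_succ, ← mul_assoc]

/-- Flatness beats the denominator, uniformly in `c ≥ 0`. -/
theorem IsFlat.abs_div_le (m j : ℕ) {f : ℝ → ℝ} (hf : IsFlat f) :
    ∃ C, 0 ≤ C ∧ ∀ c, 0 ≤ c → ∀ y, |f y / (y + c) ^ m| ≤ C * |y| ^ j := by
  obtain ⟨C, hC0, hC⟩ := hf.abs_le_mul_pow (j + m)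
  refine ⟨C, hC0, fun c hc y => ?_⟩
  rcases le_or_gt y 0 with hy | hy
  · rw [hf.nonpos y hy]; simp; positivity
  · rw [abs_div, abs_of_nonneg (a := (y + c) ^ m) (by positivity), abs_of_pos hy,
      div_le_iff₀ (by positivity)]
    refine (hC y hy.le).trans ?_
    rw [pow_add, ← mul_assoc]
    gcongr
    linarith

/-- The quotient rule holds everywhere, also at a zero of the denominator, where the quotient is
`0` by convention: there the numerator vanishes to infinite order. -/
theorem IsFlat.hasDerivAt_div (m : ℕ) {f : ℝ → ℝ} (hf : IsFlat f) {c : ℝ} (hc : 0 ≤ c) (y : ℝ) :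
    HasDerivAt (fun y => f y / (y + c) ^ m)
      (deriv f y / (y + c) ^ m - m * (f y / (y + c) ^ (m + 1))) y := by
  rcases lt_trichotomy y 0 with hy | rfl | hy
  · rw [hf.nonpos y hy.le, hf.isFlat_deriv.nonpos y hy.le]
    simp only [zero_div, mul_zero, sub_zero]
    refine (hasDerivAt_const y (0 : ℝ)).congr_of_eventuallyEq ?_
    filter_upwards [gt_mem_nhds hy] with z hz
    rw [hf.nonpos z hz.le, zero_div]
  · rw [hf.nonpos 0 le_rfl, hf.isFlat_deriv.nonpos 0 le_rfl]
    simp only [zero_div, mul_zero, sub_zero]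
    obtain ⟨C, -, hC⟩ := hf.abs_div_le m 2
    rw [hasDerivAt_iff_isLittleO]
    have h1 : (fun x : ℝ => f x / (x + c) ^ m) =O[nhds 0] fun x : ℝ => x ^ 2 := by
      refine Asymptotics.IsBigO.of_bound C (Filter.Eventually.of_forall fun x => ?_)
      simpa only [Real.norm_eq_abs, abs_pow] using hC c hc x
    have h2 : (fun x : ℝ => x ^ 2) =o[nhds 0] fun x : ℝ => x := by
      simpa using Asymptotics.isLittleO_pow_id (𝕜 := ℝ) (n := 2) (by norm_num)
    simpa [hf.nonpos 0 le_rfl] using h1.trans_isLittleO h2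
  · have hpos : 0 < y + c := by linarith
    have h1 := ((hf.smooth.differentiable (by simp)) y).hasDerivAt
    have h2 : HasDerivAt (fun y : ℝ => (y + c) ^ m) (m * (y + c) ^ (m - 1)) y := by
      exact (((hasDerivAt_id y).add_const c).fun_pow m).congr_deriv (by simp)
    refine (h1.fun_div h2 (by positivity)).congr_deriv ?_
    rcases m with _ | m
    · simp
    · have : (y + c) ≠ 0 := hpos.ne'
      simp only [Nat.add_sub_cancel]
      field_simp
      ring

theorem IsFlat.contDiff_div {c : ℝ} (hc : 0 ≤ c) : ∀ (j m : ℕ) {f : ℝ → ℝ}, IsFlat f →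
    ContDiff ℝ j (fun y => f y / (y + c) ^ m) := by
  intro j
  induction j with
  | zero =>
    intro m f hf
    exact contDiff_zero.2 (continuous_iff_continuousAt.2
      fun y => (hf.hasDerivAt_div m hc y).continuousAt)
  | succ j ih =>
    intro m f hf
    have hd : deriv (fun y => f y / (y + c) ^ m) =
        fun y => deriv f y / (y + c) ^ m - m * (f y / (y + c) ^ (m + 1)) :=
      funext fun y => (hf.hasDerivAt_div m hc y).deriv
    push_cast
    refine contDiff_succ_iff_deriv.2
      ⟨fun y => (hf.hasDerivAt_div m hc y).differentiableAt, by simp, ?_⟩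
    rw [hd]
    exact (ih m hf.isFlat_deriv).sub (contDiff_const.mul (ih (m + 1) hf))

theorem IsFlat.iteratedDeriv_div_le : ∀ (j m : ℕ) {f : ℝ → ℝ}, IsFlat f →
    ∃ C, 0 ≤ C ∧ ∀ c, 0 ≤ c → ∀ y, |iteratedDeriv j (fun y => f y / (y + c) ^ m) y| ≤ C := by
  intro j
  induction j with
  | zero =>
    intro m f hf
    obtain ⟨C, h0, hC⟩ := hf.abs_div_le m 0
    exact ⟨C, h0, fun c hc y => by simpa using hC c hc y⟩
  | succ j ih =>
    intro m f hf
    obtain ⟨C₁, h₁, hC₁⟩ := ih m hf.isFlat_deriv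
    obtain ⟨C₂, h₂, hC₂⟩ := ih (m + 1) hf
    refine ⟨C₁ + m * C₂, by positivity, fun c hc y => ?_⟩
    have hd : deriv (fun y => f y / (y + c) ^ m) =
        (fun y => deriv f y / (y + c) ^ m) - fun y => (m : ℝ) • (f y / (y + c) ^ (m + 1)) :=
      funext fun y => (hf.hasDerivAt_div m hc y).deriv
    rw [iteratedDeriv_succ', hd,
      iteratedDeriv_sub (hf.isFlat_deriv.contDiff_div hc j m).contDiffAt
        ((hf.contDiff_div hc j (m + 1)).const_smul (m : ℝ)).contDiffAt,
      iteratedDeriv_fun_const_smul_field]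
    refine (abs_sub _ _).trans (add_le_add (hC₁ c hc y) ?_)
    rw [smul_eq_mul, abs_mul, Nat.abs_cast]
    exact mul_le_mul_of_nonneg_left (hC₂ c hc y) (Nat.cast_nonneg m)

/-! ### The differentiated propagator -/

theorem dPropagator_eq {K : ℝ → ℝ} (hK : IsCutoff K) (B : ℝ) {Λ : ℝ} (hΛ : 0 < Λ) (q : Mom) :
    dPropagator K B Λ q =
      deriv K (‖q‖ ^ 2 / Λ ^ 2) * (-2 * ‖q‖ ^ 2 / Λ ^ 3) / (‖q‖ ^ 2 + B) := by
  have h1 : HasDerivAt (fun l : ℝ => ‖q‖ ^ 2 / l ^ 2) (-2 * ‖q‖ ^ 2 / Λ ^ 3) Λ := by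
    have := ((hasDerivAt_pow 2 Λ).inv (by positivity)).const_mul (‖q‖ ^ 2)
    simp only [div_eq_mul_inv]
    refine this.congr_deriv ?_
    simp; field_simp
  have h2 : HasDerivAt K (deriv K (‖q‖ ^ 2 / Λ ^ 2)) (‖q‖ ^ 2 / Λ ^ 2) :=
    ((hK.smooth.differentiable (by simp)) _).hasDerivAt
  exact ((h2.comp Λ h1).div_const _).deriv

theorem IsCutoff.deriv_eq_zero {K : ℝ → ℝ} (hK : IsCutoff K) {z : ℝ} (h0 : 0 ≤ z) (h1 : z ≤ 1) :
    deriv K z = 0 := by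
  have h1' : HasDerivWithinAt K (deriv K z) (Set.Icc 0 1) z :=
    ((hK.smooth.differentiable (by simp)) z).hasDerivAt.hasDerivWithinAt
  have h2 : HasDerivWithinAt K 0 (Set.Icc 0 1) z :=
    (hasDerivWithinAt_const z _ (1 : ℝ)).congr (fun z hz => hK.eq_one z hz.1 hz.2)
      (hK.eq_one z h0 h1)
  exact (uniqueDiffOn_Icc zero_lt_one z ⟨h0, h1⟩).eq_deriv _ h1' h2

theorem IsCutoff.deriv_eq_zero_of_lt {K : ℝ → ℝ} (hK : IsCutoff K) {z : ℝ} (h : 4 < z) :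
    deriv K z = 0 := by
  have : K =ᶠ[nhds z] fun _ => 0 := by
    filter_upwards [lt_mem_nhds h] with w hw using hK.eq_zero w hw.le
  rw [this.deriv_eq]; simp

theorem dPropagator_eq_zero {K : ℝ → ℝ} (hK : IsCutoff K) (B : ℝ) {Λ : ℝ} (hΛ : 0 < Λ) {q : Mom}
    (hq : 2 * Λ < ‖q‖) : dPropagator K B Λ q = 0 := by
  rw [dPropagator_eq hK B hΛ, hK.deriv_eq_zero_of_lt]
  · simp
  · rw [lt_div_iff₀ (by positivity)]
    nlinarith

theorem dPropagator_zero {K : ℝ → ℝ} (hK : IsCutoff K) (B : ℝ) {Λ : ℝ} (hΛ : 0 < Λ) :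
    dPropagator K B Λ 0 = 0 := by
  rw [dPropagator_eq hK B hΛ]; simp

/-- The numerator of the differentiated propagator, as a function of `y = q² / Λ² - 1`. -/
def propNumerator (K : ℝ → ℝ) (y : ℝ) : ℝ := if y ≤ 0 then 0 else -2 * deriv K (1 + y) * (1 + y)

theorem propNumerator_eq {K : ℝ → ℝ} (hK : IsCutoff K) {y : ℝ} (hy : -1 ≤ y) :
    propNumerator K y = -2 * deriv K (1 + y) * (1 + y) := by
  unfold propNumerator
  split_ifs with h
  · rw [hK.deriv_eq_zero (by linarith) (by linarith)]; simp
  · rfl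

theorem isFlat_propNumerator {K : ℝ → ℝ} (hK : IsCutoff K) : IsFlat (propNumerator K) where
  smooth := by
    rw [contDiff_iff_contDiffAt]
    intro y
    rcases lt_or_ge y 0 with hy | hy
    · refine (contDiffAt_const (c := (0 : ℝ))).congr_of_eventuallyEq ?_
      filter_upwards [gt_mem_nhds hy] with z hz
      simp [propNumerator, hz.le]
    · have hd : ContDiff ℝ ∞ (deriv K) := (contDiff_infty_iff_deriv.1 hK.smooth).2
      have : ContDiff ℝ ∞ fun y => -2 * deriv K (1 + y) * (1 + y) := by fun_prop
      refine this.contDiffAt.congr_of_eventuallyEq ?_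
      filter_upwards [lt_mem_nhds (show -1 < y by linarith)] with z hz
      exact propNumerator_eq hK hz.le
  nonpos y hy := by simp [propNumerator, hy]
  large y hy := by
    rw [propNumerator_eq hK (by linarith), hK.deriv_eq_zero_of_lt (by linarith)]; simp

/-- The differentiated propagator at scale `1`, with `c = 1 + B`. -/
def unitPropagator (K : ℝ → ℝ) (c : ℝ) (x : Mom) : ℝ :=
  propNumerator K (‖x‖ ^ 2 - 1) / (‖x‖ ^ 2 - 1 + c) ^ 1

theorem dPropagator_eq_unitPropagator {K : ℝ → ℝ} (hK : IsCutoff K) (B : ℝ) {Λ : ℝ} (hΛ : 0 < Λ) :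
    dPropagator K B Λ = (Λ ^ 3)⁻¹ • fun q => unitPropagator K (1 + B / Λ ^ 2) (Λ⁻¹ • q) := by
  funext q
  have hn : ‖Λ⁻¹ • q‖ ^ 2 = ‖q‖ ^ 2 / Λ ^ 2 := by
    rw [norm_smul, norm_inv, Real.norm_eq_abs, mul_pow, inv_pow, sq_abs]; ring
  rw [Pi.smul_apply, dPropagator_eq hK B hΛ, unitPropagator, hn,
    propNumerator_eq hK (by linarith [show 0 ≤ ‖q‖ ^ 2 / Λ ^ 2 by positivity]), smul_eq_mul,
      pow_one]
  have h1 : ‖q‖ ^ 2 / Λ ^ 2 - 1 + (1 + B / Λ ^ 2) = (‖q‖ ^ 2 + B) / Λ ^ 2 := by ring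
  rw [h1, add_sub_cancel, div_div_eq_mul_div]
  have : Λ ≠ 0 := hΛ.ne'
  field_simp

theorem contDiff_unitPropagator {K : ℝ → ℝ} (hK : IsCutoff K) {c : ℝ} (hc : 0 ≤ c) :
    ContDiff ℝ ∞ (unitPropagator K c) := by
  have h : ContDiff ℝ ∞ fun y => propNumerator K y / (y + c) ^ 1 :=
    contDiff_infty.2 fun j => (isFlat_propNumerator hK).contDiff_div hc j 1
  exact h.comp ((contDiff_norm_sq ℝ).sub contDiff_const)

theorem unitPropagator_bound {K : ℝ → ℝ} (hK : IsCutoff K) (p : ℕ) :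
    ∃ C, 0 ≤ C ∧ ∀ c, 0 ≤ c → ∀ x : Mom, ‖x‖ ≤ 2 →
      ‖iteratedFDeriv ℝ p (unitPropagator K c) x‖ ≤ C := by
  choose C hC0 hC using fun j => (isFlat_propNumerator hK).iteratedDeriv_div_le j 1
  have hg : ContDiff ℝ ∞ fun x : Mom => ‖x‖ ^ 2 - 1 := (contDiff_norm_sq ℝ).sub contDiff_const
  have hD : ∀ i : ℕ, ∃ D, ∀ x ∈ Metric.closedBall (0 : Mom) 2,
      ‖iteratedFDeriv ℝ i (fun x : Mom => ‖x‖ ^ 2 - 1) x‖ ≤ D := fun i =>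
    (isCompact_closedBall _ _).exists_bound_of_continuousOn
      (hg.continuous_iteratedFDeriv (by exact_mod_cast le_top)).continuousOn
  choose D hD using hD
  have hD0 : ∀ i, 0 ≤ D i := fun i => (norm_nonneg _).trans (hD i 0 (by simp))
  set D' := 1 + ∑ i ∈ Finset.range (p + 1), D i with hD'
  have hD1 : 1 ≤ D' := by
    have := Finset.sum_nonneg fun i (_ : i ∈ Finset.range (p + 1)) => hD0 i
    linarith
  set C' := ∑ i ∈ Finset.range (p + 1), C i with hC'
  have hC'0 : 0 ≤ C' := Finset.sum_nonneg fun i _ => hC0 i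
  refine ⟨p.factorial * C' * D' ^ p, by positivity, fun c hc x hx => ?_⟩
  have h : ContDiff ℝ ∞ fun y => propNumerator K y / (y + c) ^ 1 :=
    contDiff_infty.2 fun j => (isFlat_propNumerator hK).contDiff_div hc j 1
  refine norm_iteratedFDeriv_comp_le (g := fun y => propNumerator K y / (y + c) ^ 1)
    (f := fun x : Mom => ‖x‖ ^ 2 - 1) h hg (by exact_mod_cast le_top) x ?_ ?_
  · intro i hi
    rw [norm_iteratedFDeriv_eq_norm_iteratedDeriv]
    exact (hC i c hc _).trans
      (Finset.single_le_sum (fun i _ => hC0 i) (Finset.mem_range.2 (Nat.lt_succ_of_le hi)))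
  · intro i h1 hi
    refine (hD i x (by simpa using hx)).trans ?_
    have : D i ≤ D' := by
      have := Finset.single_le_sum (f := D) (fun i _ => hD0 i)
        (Finset.mem_range.2 (Nat.lt_succ_of_le hi))
      linarith
    exact this.trans (le_self_pow₀ hD1 (by omega))

theorem one_add_div_nonneg {B Λ : ℝ} (hΛ : 0 < Λ) (hB : |B| ≤ Λ ^ 2) : 0 ≤ 1 + B / Λ ^ 2 := by
  have h : -1 ≤ B / Λ ^ 2 := by
    rw [le_div_iff₀ (by positivity)]
    linarith [(abs_le.1 hB).1]
  linarith

theorem contDiff_dPropagator {K : ℝ → ℝ} (hK : IsCutoff K) {B Λ : ℝ} (hΛ : 0 < Λ)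
    (hB : |B| ≤ Λ ^ 2) : ContDiff ℝ ∞ (dPropagator K B Λ) := by
  rw [dPropagator_eq_unitPropagator hK B hΛ]
  exact ((contDiff_unitPropagator hK (one_add_div_nonneg hΛ hB)).comp
    (contDiff_const_smul (Λ⁻¹ : ℝ))).const_smul ((Λ ^ 3)⁻¹ : ℝ)

/-- The bounds are uniform in `B`, up to the value `B = -Λ²` for which the denominator vanishes on
the boundary of the support of the numerator. -/
theorem dPropagator_bound {K : ℝ → ℝ} (hK : IsCutoff K) (p : ℕ) :
    ∃ C, 0 ≤ C ∧ ∀ B Λ, 0 < Λ → |B| ≤ Λ ^ 2 → ∀ q : Mom, ‖q‖ ≤ 2 * Λ →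
      ‖iteratedFDeriv ℝ p (dPropagator K B Λ) q‖ ≤ Λ ^ (-3 - p : ℤ) * C := by
  obtain ⟨C, hC0, hC⟩ := unitPropagator_bound hK p
  refine ⟨C, hC0, fun B Λ hΛ hB q hq => ?_⟩
  have hc := one_add_div_nonneg hΛ hB
  have hs := contDiff_unitPropagator hK hc
  have hs' : ContDiff ℝ ∞ fun q : Mom => unitPropagator K (1 + B / Λ ^ 2) (Λ⁻¹ • q) :=
    hs.comp (contDiff_const_smul _)
  rw [dPropagator_eq_unitPropagator hK B hΛ,
    iteratedFDeriv_const_smul_apply (hs'.contDiffAt.of_le (by exact_mod_cast le_top)), norm_smul,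
    iteratedFDeriv_comp_const_smul _ (hs.of_le (by exact_mod_cast le_top)), norm_smul]
  have hq' : ‖Λ⁻¹ • q‖ ≤ 2 := by
    rw [norm_smul, norm_inv, Real.norm_eq_abs, abs_of_pos hΛ, inv_mul_le_iff₀ hΛ]; linarith
  have e : Λ ^ (-3 - p : ℤ) = ‖(Λ ^ 3)⁻¹‖ * ‖Λ⁻¹ ^ p‖ := by
    rw [Real.norm_of_nonneg (by positivity), Real.norm_of_nonneg (by positivity), sub_eq_add_neg,
      zpow_add₀ hΛ.ne', zpow_neg, zpow_neg, inv_pow]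
    norm_cast
  rw [e, mul_assoc]
  gcongr
  exact hC _ hc _ hq'

/-! ### Functions on the hyperplane of conserved momenta -/

/-- The projection `kᵢ ↦ kᵢ - n⁻¹ (k₁ + ⋯ + kₙ)` onto the hyperplane of conserved momenta. -/
def conservedProj (n : ℕ) : (Fin n → Mom) →L[ℝ] (Fin n → Mom) :=
  ContinuousLinearMap.pi fun i =>
    ContinuousLinearMap.proj i - (n : ℝ)⁻¹ • ∑ j, ContinuousLinearMap.proj j

theorem conservedProj_apply {n : ℕ} (k : Fin n → Mom) (i : Fin n) :
    conservedProj n k i = k i - (n : ℝ)⁻¹ • ∑ j, k j := by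
  simp [conservedProj]

theorem conserved_conservedProj {n : ℕ} (hn : 1 ≤ n) (k : Fin n → Mom) :
    Conserved (conservedProj n k) := by
  have : (n : ℝ) ≠ 0 := by positivity
  simp only [Conserved, conservedProj_apply, Finset.sum_sub_distrib, Finset.sum_const,
    Finset.card_univ, Fintype.card_fin]
  rw [← Nat.cast_smul_eq_nsmul ℝ, smul_smul, mul_inv_cancel₀ this, one_smul, sub_self]

theorem conservedProj_of_conserved {n : ℕ} {k : Fin n → Mom} (hk : Conserved k) :
    conservedProj n k = k := by
  funext i
  rw [conservedProj_apply, show ∑ j, k j = 0 from hk, smul_zero, sub_zero]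

theorem conserved_momDir {n : ℕ} (a : Fin n × Fin n × Fin 4) : Conserved (momDir a) := by
  simp [Conserved, momDir, Finset.sum_sub_distrib]

theorem conserved_zero (n : ℕ) : Conserved (0 : Fin n → Mom) := by simp [Conserved]

/-- The projected unit vectors are averages of the directions of the admissible derivatives. -/
theorem conservedProj_single {n : ℕ} (hn : 1 ≤ n) (i : Fin n) (μ : Fin 4) :
    conservedProj n (Pi.single i (EuclideanSpace.single μ (1 : ℝ))) =
      (n : ℝ)⁻¹ • ∑ j, momDir (i, j, μ) := by
  have h0 : (n : ℝ) ≠ 0 := by positivity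
  funext l
  rw [conservedProj_apply, Pi.smul_apply, Finset.sum_apply]
  have h1 : ∑ j, (Pi.single i (EuclideanSpace.single μ (1 : ℝ)) : Fin n → Mom) j =
      EuclideanSpace.single μ (1 : ℝ) := by simp
  have h2 : ∑ j, (momDir (i, j, μ) : Fin n → Mom) l =
      (n : ℝ) • (Pi.single i (EuclideanSpace.single μ (1 : ℝ)) : Fin n → Mom) l -
        EuclideanSpace.single μ (1 : ℝ) := by
    simp only [momDir, Pi.sub_apply, Finset.sum_sub_distrib, Finset.sum_const, Finset.card_univ,
      Fintype.card_fin, Nat.cast_smul_eq_nsmul]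
    congr 1
    simp [Pi.single_apply]
  rw [h1, h2, smul_sub, smul_smul, inv_mul_cancel₀ h0, one_smul]

theorem norm_momDir_le {n : ℕ} (a : Fin n × Fin n × Fin 4) : ‖momDir a‖ ≤ 2 := by
  refine (norm_sub_le _ _).trans ?_
  rw [Pi.norm_single, Pi.norm_single]
  simp; norm_num

theorem prod_norm_momDir_le {n p : ℕ} (a : Fin p → Fin n × Fin n × Fin 4) :
    ∏ i, ‖momDir (a i)‖ ≤ 2 ^ p := by
  calc ∏ i, ‖momDir (a i)‖ ≤ ∏ _i : Fin p, (2 : ℝ) :=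
        Finset.prod_le_prod (fun _ _ => norm_nonneg _) fun i _ => norm_momDir_le _
    _ = 2 ^ p := by simp

/-- The function on all of momentum space that extends the restriction of `f` to the hyperplane of
conserved momenta. -/
def hyperplaneExt {n : ℕ} (f : (Fin n → Mom) → ℝ) : (Fin n → Mom) → ℝ :=
  fun k => f (conservedProj n k)

theorem contDiff_hyperplaneExt {n : ℕ} {f : (Fin n → Mom) → ℝ} (hf : ContDiff ℝ ∞ f) :
    ContDiff ℝ ∞ (hyperplaneExt f) := hf.comp (conservedProj n).contDiff

theorem hyperplaneExt_of_conserved {n : ℕ} (f : (Fin n → Mom) → ℝ) {k : Fin n → Mom}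
    (hk : Conserved k) : hyperplaneExt f k = f k := by
  rw [hyperplaneExt, conservedProj_of_conserved hk]

theorem hyperplaneExt_congr {n : ℕ} (hn : 1 ≤ n) {f g : (Fin n → Mom) → ℝ}
    (h : ∀ k, Conserved k → f k = g k) : hyperplaneExt f = hyperplaneExt g :=
  funext fun k => h _ (conserved_conservedProj hn k)

theorem iteratedFDeriv_hyperplaneExt {n p : ℕ} {f : (Fin n → Mom) → ℝ} (hf : ContDiff ℝ ∞ f)
    (k : Fin n → Mom) (v : Fin p → Fin n → Mom) :
    iteratedFDeriv ℝ p (hyperplaneExt f) k v =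
      iteratedFDeriv ℝ p f (conservedProj n k) fun m => conservedProj n (v m) := by
  have := (conservedProj n).iteratedFDeriv_comp_right hf k (i := p) (by exact_mod_cast le_top)
  change iteratedFDeriv ℝ p (f ∘ conservedProj n) k v = _
  rw [this]; rfl

theorem momDeriv_hyperplaneExt {n p : ℕ} {f : (Fin n → Mom) → ℝ} (hf : ContDiff ℝ ∞ f)
    (a : Fin p → Fin n × Fin n × Fin 4) {k : Fin n → Mom} (hk : Conserved k) :
    momDeriv a (hyperplaneExt f) k = momDeriv a f k := by
  simp only [momDeriv, iteratedFDeriv_hyperplaneExt hf, conservedProj_of_conserved hk,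
    conservedProj_of_conserved (conserved_momDir _)]

theorem momDeriv_congr {n p : ℕ} (hn : 1 ≤ n) {f g : (Fin n → Mom) → ℝ} (hf : ContDiff ℝ ∞ f)
    (hg : ContDiff ℝ ∞ g) (h : ∀ k, Conserved k → f k = g k)
    (a : Fin p → Fin n × Fin n × Fin 4) {k : Fin n → Mom} (hk : Conserved k) :
    momDeriv a f k = momDeriv a g k := by
  rw [← momDeriv_hyperplaneExt hf a hk, ← momDeriv_hyperplaneExt hg a hk, hyperplaneExt_congr hn h]

theorem abs_momDeriv_le {n p : ℕ} (a : Fin p → Fin n × Fin n × Fin 4) (f : (Fin n → Mom) → ℝ)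
    (k : Fin n → Mom) : |momDeriv a f k| ≤ 2 ^ p * ‖iteratedFDeriv ℝ p f k‖ := by
  refine ((iteratedFDeriv ℝ p f k).le_opNorm _).trans ?_
  rw [mul_comm]
  gcongr
  exact prod_norm_momDir_le a

/-- The admissible derivatives control all derivatives of the extended function. -/
theorem norm_iteratedFDeriv_hyperplaneExt_le {n p : ℕ} (hn : 1 ≤ n) {f : (Fin n → Mom) → ℝ}
    (hf : ContDiff ℝ ∞ f) {k : Fin n → Mom} (hk : Conserved k) {C : ℝ}
    (h : ∀ a : Fin p → Fin n × Fin n × Fin 4, |momDeriv a f k| ≤ C) :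
    ‖iteratedFDeriv ℝ p (hyperplaneExt f) k‖ ≤ (4 * n) ^ p * C := by
  have h0 : (n : ℝ) ≠ 0 := by positivity
  have hC : 0 ≤ C := (abs_nonneg _).trans (h fun _ => (⟨0, hn⟩, ⟨0, hn⟩, 0))
  have hproj : ∀ v : Fin n → Mom, conservedProj n v =
      ∑ x : Fin n × Fin n × Fin 4, ((n : ℝ)⁻¹ * v x.1 x.2.2) • momDir x := by
    intro v
    have hv : v = ∑ i, ∑ μ, v i μ • Pi.single i (EuclideanSpace.single μ (1 : ℝ)) := by
      funext l
      ext ν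
      simp [Finset.sum_apply, Pi.single_apply, Finset.sum_ite_eq, apply_ite]
    conv_lhs => rw [hv]
    simp only [map_sum, map_smul, conservedProj_single hn, Fintype.sum_prod_type]
    refine Finset.sum_congr rfl fun i _ => ?_
    rw [Finset.sum_comm]
    refine Finset.sum_congr rfl fun μ _ => ?_
    rw [smul_smul, Finset.smul_sum, mul_comm]
  refine ContinuousMultilinearMap.opNorm_le_bound (by positivity) fun v => ?_
  rw [iteratedFDeriv_hyperplaneExt hf, conservedProj_of_conserved hk]
  simp only [hproj]
  rw [ContinuousMultilinearMap.map_sum]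
  simp only [ContinuousMultilinearMap.map_smul_univ]
  refine (Finset.abs_sum_le_sum_abs _ _).trans ?_
  have hterm : ∀ a : Fin p → Fin n × Fin n × Fin 4,
      |(∏ m, ((n : ℝ)⁻¹ * v m (a m).1 (a m).2.2)) • iteratedFDeriv ℝ p f k
        (fun m => momDir (a m))| ≤ (∏ m, ((n : ℝ)⁻¹ * ‖v m‖)) * C := by
    intro a
    rw [smul_eq_mul, abs_mul, Finset.abs_prod]
    gcongr with m _
    · rw [abs_mul, abs_of_nonneg (by positivity)]
      gcongr
      exact (PiLp.norm_apply_le (v m (a m).1) _).trans (norm_le_pi_norm (v m) _)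
    · exact h a
  refine (Finset.sum_le_sum fun a _ => hterm a).trans (le_of_eq ?_)
  rw [Finset.sum_const, Finset.prod_mul_distrib]
  simp
  field_simp
  simp only [mul_pow]
  ring

/-- Conserved momenta of size at most `ρ`. -/
def momBall (n : ℕ) (ρ : ℝ) : Set (Fin n → Mom) := {k | Conserved k ∧ ‖k‖ ≤ ρ}

theorem mem_region_iff {n : ℕ} {Λ : ℝ} (hΛ : 0 < Λ) {k : Fin n → Mom} :
    k ∈ region n Λ ↔ Conserved k ∧ ‖k‖ ≤ 2 * Λ := by
  rw [pi_norm_le_iff_of_nonneg (by positivity)]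
  refine and_congr_right fun _ => forall_congr' fun i => ?_
  rw [show 4 * Λ ^ 2 = (2 * Λ) ^ 2 by ring, sq_le_sq₀ (norm_nonneg _) (by positivity)]

theorem region_eq_momBall {n : ℕ} {Λ : ℝ} (hΛ : 0 < Λ) : region n Λ = momBall n (2 * Λ) :=
  Set.ext fun _ => mem_region_iff hΛ

theorem zero_mem_momBall (n : ℕ) {ρ : ℝ} (hρ : 0 ≤ ρ) : (0 : Fin n → Mom) ∈ momBall n ρ :=
  ⟨conserved_zero n, by simpa using hρ⟩

theorem momBall_mono {n : ℕ} {ρ ρ' : ℝ} (h : ρ ≤ ρ') : momBall n ρ ⊆ momBall n ρ' :=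
  fun _ hk => ⟨hk.1, hk.2.trans h⟩

theorem convex_momBall (n : ℕ) (ρ : ℝ) : Convex ℝ (momBall n ρ) := by
  intro k hk l hl a b ha hb hab
  refine ⟨?_, ?_⟩
  · have h1 := hk.1
    have h2 := hl.1
    simp only [Conserved, Pi.add_apply, Pi.smul_apply, Finset.sum_add_distrib, ← Finset.smul_sum]
      at *
    rw [h1, h2]; simp
  · refine (norm_add_le _ _).trans ?_
    rw [norm_smul, norm_smul, Real.norm_of_nonneg ha, Real.norm_of_nonneg hb]
    calc a * ‖k‖ + b * ‖l‖ ≤ a * ρ + b * ρ := by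
          gcongr
          exacts [hk.2, hl.2]
      _ = ρ := by rw [← add_mul, hab, one_mul]

/-- The mean value inequality that passes from derivatives of order `p + 1` to those of order `p`.
-/
theorem momDeriv_le_of_zero {n p : ℕ} (hn : 1 ≤ n) {f : (Fin n → Mom) → ℝ} (hf : ContDiff ℝ ∞ f)
    {ρ C c : ℝ} (hρ : 0 ≤ ρ)
    (h : ∀ (a : Fin (p + 1) → Fin n × Fin n × Fin 4), ∀ k ∈ momBall n ρ, |momDeriv a f k| ≤ C)
    (h0 : ∀ a : Fin p → Fin n × Fin n × Fin 4, |momDeriv a f 0| ≤ c)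
    (a : Fin p → Fin n × Fin n × Fin 4) {k : Fin n → Mom} (hk : k ∈ momBall n ρ) :
    |momDeriv a f k| ≤ c + 2 ^ p * ((4 * n) ^ (p + 1) * C * ρ) := by
  have hs := contDiff_hyperplaneExt hf
  have hC : 0 ≤ C := (abs_nonneg _).trans (h (fun _ => (⟨0, hn⟩, ⟨0, hn⟩, 0)) k hk)
  have key := (convex_momBall n ρ).norm_image_sub_le_of_norm_fderiv_le (𝕜 := ℝ)
    (f := iteratedFDeriv ℝ p (hyperplaneExt f)) (C := (4 * n) ^ (p + 1) * C)
    (fun x _ => (hs.differentiable_iteratedFDeriv (by exact_mod_cast WithTop.coe_lt_top _)) x)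
    (fun x hx => by
      rw [norm_fderiv_iteratedFDeriv]
      exact norm_iteratedFDeriv_hyperplaneExt_le hn hf hx.1 fun a => h a x hx)
    (zero_mem_momBall n hρ) hk
  rw [sub_zero] at key
  have e : momDeriv a f k = momDeriv a f 0 +
      (iteratedFDeriv ℝ p (hyperplaneExt f) k - iteratedFDeriv ℝ p (hyperplaneExt f) 0)
        fun m => momDir (a m) := by
    rw [← momDeriv_hyperplaneExt hf a hk.1, ← momDeriv_hyperplaneExt hf a (conserved_zero n)]
    simp [momDeriv]
  rw [e]
  refine (abs_add_le _ _).trans (add_le_add (h0 a) ?_)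
  refine ((iteratedFDeriv ℝ p (hyperplaneExt f) k -
    iteratedFDeriv ℝ p (hyperplaneExt f) 0).le_opNorm _).trans ?_
  rw [mul_comm]
  gcongr
  · exact prod_norm_momDir_le a
  · refine key.trans ?_
    gcongr
    exact hk.2

/-! ### Integrals depending on a parameter -/

section ParametricIntegral

open MeasureTheory

variable {E G : Type} [NormedAddCommGroup E] [NormedSpace ℝ E] [FiniteDimensional ℝ E]
  [NormedAddCommGroup G] [NormedSpace ℝ G]

/-- Differentiation under an integral with a continuous weight `w` supported in a ball. -/
theorem hasFDerivAt_integral_smul {w : Mom → ℝ} (hw : Continuous w) {ρ : ℝ}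
    (hsupp : ∀ q, ρ < ‖q‖ → w q = 0) {F : E × Mom → G} (hF : ContDiff ℝ 1 F) (k : E) :
    HasFDerivAt (fun k => ∫ q, w q • F (k, q))
      (∫ q, w q • (fderiv ℝ F (k, q)).comp (ContinuousLinearMap.inl ℝ E Mom)) k := by
  have hcomp : HasCompactSupport w :=
    HasCompactSupport.of_support_subset_isCompact (isCompact_closedBall (0 : Mom) ρ) fun q hq => by
      by_contra h
      exact hq (hsupp q (by simpa using h))
  have hfd : Continuous fun x : E × Mom => (fderiv ℝ F x).comp (ContinuousLinearMap.inl ℝ E Mom) :=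
    (hF.continuous_fderiv (by simp)).clm_comp continuous_const
  obtain ⟨C, hC⟩ := ((isCompact_closedBall k 1).prod
    (isCompact_closedBall (0 : Mom) ρ)).exists_bound_of_continuousOn hfd.continuousOn
  have hint : ∀ {H : Type} [NormedAddCommGroup H] [NormedSpace ℝ H] {g : E × Mom → H}
      (_ : Continuous g) (k : E), Integrable fun q => w q • g (k, q) := by
    intro H _ _ g hg k
    refine Continuous.integrable_of_hasCompactSupport (by fun_prop) ?_
    exact hcomp.smul_right
  refine hasFDerivAt_integral_of_dominated_of_fderiv_le (s := Metric.closedBall k 1)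
    (bound := fun q => |w q| * C)
    (F' := fun k q => w q • (fderiv ℝ F (k, q)).comp (ContinuousLinearMap.inl ℝ E Mom))
    (Metric.closedBall_mem_nhds k one_pos)
    (Filter.Eventually.of_forall fun k => (hint hF.continuous k).aestronglyMeasurable)
    (hint hF.continuous k) (hint hfd k).aestronglyMeasurable
    (Filter.Eventually.of_forall fun q l hl => ?_)
    ((hw.abs.integrable_of_hasCompactSupport (hcomp.comp_left abs_zero)).mul_const C)
    (Filter.Eventually.of_forall fun q l _ => ?_)
  · rw [norm_smul, Real.norm_eq_abs]
    rcases le_or_gt ‖q‖ ρ with h | h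
    · gcongr
      exact hC (l, q) ⟨hl, by simpa using h⟩
    · rw [hsupp q h]; simp
  · have h1 : HasFDerivAt F (fderiv ℝ F (l, q)) (l, q) :=
      ((hF.differentiable (by simp)) _).hasFDerivAt
    have h2 : HasFDerivAt (fun l : E => (l, q)) (ContinuousLinearMap.inl ℝ E Mom) l :=
      hasFDerivAt_prodMk_left l q
    exact (h1.comp l h2).const_smul (w q)

theorem contDiff_integral_smul {w : Mom → ℝ} (hw : Continuous w) {ρ : ℝ}
    (hsupp : ∀ q, ρ < ‖q‖ → w q = 0) : ∀ (j : ℕ) {G : Type} [NormedAddCommGroup G]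
    [NormedSpace ℝ G] {F : E × Mom → G}, ContDiff ℝ ∞ F →
    ContDiff ℝ j fun k => ∫ q, w q • F (k, q) := by
  intro j
  induction j with
  | zero =>
    intro G _ _ F hF
    exact contDiff_zero.2 (continuous_iff_continuousAt.2 fun k =>
      (hasFDerivAt_integral_smul hw hsupp (hF.of_le (by exact_mod_cast le_top)) k).continuousAt)
  | succ j ih =>
    intro G _ _ F hF
    have hF1 : ContDiff ℝ 1 F := hF.of_le (by exact_mod_cast le_top)
    push_cast
    refine contDiff_succ_iff_fderiv.2
      ⟨fun k => (hasFDerivAt_integral_smul hw hsupp hF1 k).differentiableAt, by simp, ?_⟩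
    have : (fderiv ℝ fun k => ∫ q, w q • F (k, q)) = fun k =>
        ∫ q, w q • (fun x => (fderiv ℝ F x).comp (ContinuousLinearMap.inl ℝ E Mom)) (k, q) :=
      funext fun k => (hasFDerivAt_integral_smul hw hsupp hF1 k).fderiv
    rw [this]
    exact ih ((contDiff_infty_iff_fderiv.1 hF).2.clm_comp contDiff_const)

/-- Derivatives of the integral are bounded by those of the integrand on the support of the weight.
The
values are taken in a general space because the induction on the order replaces `F` by its
derivative
in the parameter. -/
theorem norm_iteratedFDeriv_integral_smul_le {w : Mom → ℝ} (hw : Continuous w) {ρ : ℝ}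
    (hsupp : ∀ q, ρ < ‖q‖ → w q = 0) {c : ℝ} (hc : ∀ q, ‖q‖ ≤ ρ → |w q| ≤ c) {k : E} {C : ℝ} :
    ∀ (j : ℕ) {G : Type} [NormedAddCommGroup G]
    [NormedSpace ℝ G] {F : E × Mom → G}, ContDiff ℝ ∞ F →
    (∀ q, ‖q‖ ≤ ρ → ‖iteratedFDeriv ℝ j (fun k => F (k, q)) k‖ ≤ C) →
    ‖iteratedFDeriv ℝ j (fun k => ∫ q, w q • F (k, q)) k‖ ≤
      c * C * volume.real (Metric.closedBall (0 : Mom) ρ) := by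
  intro j
  induction j with
  | zero =>
    intro G _ _ F hF h
    rw [norm_iteratedFDeriv_zero, ← setIntegral_eq_integral_of_forall_compl_eq_zero
      (s := Metric.closedBall (0 : Mom) ρ)
      (fun q hq => by rw [hsupp q (by simpa using hq), zero_smul])]
    refine norm_setIntegral_le_of_norm_le_const measure_closedBall_lt_top fun q hq => ?_
    have hq' : ‖q‖ ≤ ρ := by simpa using hq
    rw [norm_smul]
    have := h q hq'
    rw [norm_iteratedFDeriv_zero] at this
    exact mul_le_mul (hc q hq') this (norm_nonneg _) ((abs_nonneg _).trans (hc q hq'))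
  | succ j ih =>
    intro G _ _ F hF h
    have hF1 : ContDiff ℝ 1 F := hF.of_le (by exact_mod_cast le_top)
    rw [← norm_iteratedFDeriv_fderiv]
    have : (fderiv ℝ fun k => ∫ q, w q • F (k, q)) = fun k =>
        ∫ q, w q • (fun x => (fderiv ℝ F x).comp (ContinuousLinearMap.inl ℝ E Mom)) (k, q) :=
      funext fun k => (hasFDerivAt_integral_smul hw hsupp hF1 k).fderiv
    have hsm : ContDiff ℝ ∞ fun x => (fderiv ℝ F x).comp (ContinuousLinearMap.inl ℝ E Mom) :=
      (contDiff_infty_iff_fderiv.1 hF).2.clm_comp contDiff_const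
    have h2 : ∀ q, (fun l => (fderiv ℝ F (l, q)).comp (ContinuousLinearMap.inl ℝ E Mom)) =
        fderiv ℝ fun l => F (l, q) := by
      intro q
      funext l
      have h1 : HasFDerivAt F (fderiv ℝ F (l, q)) (l, q) :=
        ((hF1.differentiable (by simp)) _).hasFDerivAt
      exact ((h1.comp l (hasFDerivAt_prodMk_left l q)).fderiv).symm
    have key := ih (F := fun x => (fderiv ℝ F x).comp (ContinuousLinearMap.inl ℝ E Mom)) hsm
      fun q hq => by
        rw [h2, norm_iteratedFDeriv_fderiv]
        exact h q hq
    rw [this]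
    exact key

end ParametricIntegral

theorem volume_real_closedBall_two_mul {Λ : ℝ} (hΛ : 0 < Λ) :
    MeasureTheory.volume.real (Metric.closedBall (0 : Mom) (2 * Λ)) =
      Λ ^ 4 * MeasureTheory.volume.real (Metric.closedBall (0 : Mom) 2) := by
  rw [MeasureTheory.measureReal_def, MeasureTheory.measureReal_def, mul_comm 2 Λ,
    MeasureTheory.Measure.addHaar_closedBall_mul _ _ hΛ.le (by norm_num), ENNReal.toReal_mul,
    ENNReal.toReal_ofReal (by positivity)]
  simp

/-! ### Polynomials with nonnegative coefficients -/

theorem IsPln.zero : IsPln 0 := fun i => by simp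

theorem IsPln.C {c : ℝ} (hc : 0 ≤ c) : IsPln (Polynomial.C c) := fun i => by
  rw [Polynomial.coeff_C]; split_ifs <;> simp [hc]

theorem IsPln.X : IsPln Polynomial.X := fun i => by
  rw [Polynomial.coeff_X]; split_ifs <;> simp

theorem IsPln.add {P Q : Polynomial ℝ} (hP : IsPln P) (hQ : IsPln Q) : IsPln (P + Q) := fun i => by
  rw [Polynomial.coeff_add]; exact add_nonneg (hP i) (hQ i)

theorem IsPln.mul {P Q : Polynomial ℝ} (hP : IsPln P) (hQ : IsPln Q) : IsPln (P * Q) := fun i => by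
  rw [Polynomial.coeff_mul]; exact Finset.sum_nonneg fun _ _ => mul_nonneg (hP _) (hQ _)

theorem IsPln.sum {ι : Type*} {s : Finset ι} {P : ι → Polynomial ℝ} (h : ∀ i ∈ s, IsPln (P i)) :
    IsPln (∑ i ∈ s, P i) := fun j => by
  rw [Polynomial.finsetSum_coeff]; exact Finset.sum_nonneg fun i hi => h i hi j

theorem IsPln.eval_nonneg {P : Polynomial ℝ} (hP : IsPln P) {x : ℝ} (hx : 0 ≤ x) :
    0 ≤ P.eval x := by
  rw [Polynomial.eval_eq_sum]
  exact Finset.sum_nonneg fun i _ => mul_nonneg (hP i) (pow_nonneg hx i)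

/-! ### Power counting -/

/-- The polynomials that the Leibniz rule produces from those of two factors. -/
def leibnizPoly (Q Q' : ℕ → Polynomial ℝ) (p : ℕ) : Polynomial ℝ :=
  ∑ i ∈ Finset.range (p + 1), Polynomial.C (p.choose i : ℝ) * Q i * Q' (p - i)

/-- The polynomials that the chain rule produces for a linear map of norm `c`. -/
def dilatePoly (c : ℝ) (Q : ℕ → Polynomial ℝ) (p : ℕ) : Polynomial ℝ := Polynomial.C (c ^ p) * Q p

theorem isPln_leibnizPoly {Q Q' : ℕ → Polynomial ℝ} (hQ : ∀ p, IsPln (Q p))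
    (hQ' : ∀ p, IsPln (Q' p)) (p : ℕ) : IsPln (leibnizPoly Q Q' p) :=
  IsPln.sum fun i _ => ((IsPln.C (Nat.cast_nonneg _)).mul (hQ i)).mul (hQ' (p - i))

theorem isPln_dilatePoly {c : ℝ} (hc : 0 ≤ c) {Q : ℕ → Polynomial ℝ} (hQ : ∀ p, IsPln (Q p))
    (p : ℕ) : IsPln (dilatePoly c Q p) := (IsPln.C (pow_nonneg hc p)).mul (hQ p)

/-- At the point `k`, all derivatives of `f` are bounded as if `f` had momentum dimension `α`, up to
a factor `M` and polynomials `Q` (one for each order of differentiation) in `x`. -/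
def ScaleBound {E : Type*} [NormedAddCommGroup E] [NormedSpace ℝ E] (f : E → ℝ) (k : E)
    (Λ M : ℝ) (α : ℤ) (x : ℝ) (Q : ℕ → Polynomial ℝ) : Prop :=
  ∀ p : ℕ, ‖iteratedFDeriv ℝ p f k‖ ≤ M * Λ ^ (α - p) * (Q p).eval x

section ScaleBound

variable {E F : Type*} [NormedAddCommGroup E] [NormedSpace ℝ E] [NormedAddCommGroup F]
  [NormedSpace ℝ F] {f g : E → ℝ} {k : E} {Λ M M' x : ℝ} {α β : ℤ} {Q Q' : ℕ → Polynomial ℝ}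

theorem scaleBound_of_eventuallyEq_zero (h : f =ᶠ[nhds k] fun _ => 0) (hΛ : 0 < Λ) (hM : 0 ≤ M)
    (hx : 0 ≤ x) (hQ : ∀ p, IsPln (Q p)) : ScaleBound f k Λ M α x Q := fun p => by
  have : iteratedFDeriv ℝ p f k = 0 := by
    rw [(h.iteratedFDeriv ℝ p).eq_of_nhds, iteratedFDeriv_fun_zero]
    rfl
  rw [this, norm_zero]
  have := (hQ p).eval_nonneg hx
  positivity

theorem ScaleBound.add (hf : ContDiff ℝ ∞ f) (hg : ContDiff ℝ ∞ g)
    (h : ScaleBound f k Λ M α x Q) (h' : ScaleBound g k Λ M α x Q') :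
    ScaleBound (f + g) k Λ M α x (fun p => Q p + Q' p) := fun p => by
  rw [iteratedFDeriv_add_apply (hf.contDiffAt.of_le (by exact_mod_cast le_top))
    (hg.contDiffAt.of_le (by exact_mod_cast le_top)), Polynomial.eval_add, mul_add]
  exact (norm_add_le _ _).trans (add_le_add (h p) (h' p))

theorem ScaleBound.sum {ι : Type*} {s : Finset ι} {f : ι → E → ℝ} {Q : ι → ℕ → Polynomial ℝ}
    (hf : ∀ i ∈ s, ContDiff ℝ ∞ (f i)) (h : ∀ i ∈ s, ScaleBound (f i) k Λ M α x (Q i)) :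
    ScaleBound (fun y => ∑ i ∈ s, f i y) k Λ M α x (fun p => ∑ i ∈ s, Q i p) := fun p => by
  have hf' : ∀ i ∈ s, ContDiffAt ℝ p (f i) k := fun i hi =>
    (hf i hi).contDiffAt.of_le (by exact_mod_cast le_top)
  have e : (fun y => ∑ i ∈ s, f i y) = ∑ i ∈ s, f i := by
    funext y; simp
  rw [e, iteratedFDeriv_sum_apply hf', Polynomial.eval_finsetSum, Finset.mul_sum]
  exact (norm_sum_le _ _).trans (Finset.sum_le_sum fun i hi => h i hi p)

theorem ScaleBound.const_mul (hf : ContDiff ℝ ∞ f) (h : ScaleBound f k Λ M α x Q) (c : ℝ) :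
    ScaleBound (fun y => c * f y) k Λ M α x (fun p => Polynomial.C |c| * Q p) := fun p => by
  have e : (fun y => c * f y) = c • f := by funext y; simp
  rw [e, iteratedFDeriv_const_smul_apply (hf.contDiffAt.of_le (by exact_mod_cast le_top)),
    norm_smul,
    Polynomial.eval_mul, Polynomial.eval_C, Real.norm_eq_abs]
  calc |c| * ‖iteratedFDeriv ℝ p f k‖ ≤ |c| * (M * Λ ^ (α - p) * (Q p).eval x) := by
        gcongr; exact h p
    _ = _ := by ring

theorem ScaleBound.mul (hΛ : 0 < Λ) (hM : 0 ≤ M) (hx : 0 ≤ x) (hQ : ∀ p, IsPln (Q p))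
    (hf : ContDiff ℝ ∞ f) (hg : ContDiff ℝ ∞ g)
    (h : ScaleBound f k Λ M α x Q) (h' : ScaleBound g k Λ M' β x Q') :
    ScaleBound (fun y => f y * g y) k Λ (M * M') (α + β) x (leibnizPoly Q Q') := fun p => by
  refine (norm_iteratedFDeriv_mul_le hf hg k (by exact_mod_cast le_top)).trans ?_
  rw [leibnizPoly, Polynomial.eval_finsetSum, Finset.mul_sum]
  refine Finset.sum_le_sum fun i hi => ?_
  have hi' : i ≤ p := Nat.lt_succ_iff.1 (Finset.mem_range.1 hi)
  have h0 := (hQ i).eval_nonneg hx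
  calc (p.choose i : ℝ) * ‖iteratedFDeriv ℝ i f k‖ * ‖iteratedFDeriv ℝ (p - i) g k‖
      ≤ p.choose i * (M * Λ ^ (α - i) * (Q i).eval x) *
          (M' * Λ ^ (β - (p - i : ℕ)) * (Q' (p - i)).eval x) := by
        gcongr
        · exact h i
        · exact h' (p - i)
    _ = _ := by
        have e : Λ ^ (α + β - p) = Λ ^ (α - i) * Λ ^ (β - (p - i : ℕ)) := by
          rw [← zpow_add₀ hΛ.ne', Nat.cast_sub hi']
          congr 1; ring
        rw [e, Polynomial.eval_mul, Polynomial.eval_mul, Polynomial.eval_C]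
        ring

theorem ScaleBound.comp_clm {f : F → ℝ} (hf : ContDiff ℝ ∞ f) (T : E →L[ℝ] F)
    (h : ScaleBound f (T k) Λ M α x Q) :
    ScaleBound (fun y => f (T y)) k Λ M α x (dilatePoly ‖T‖ Q) := fun p => by
  change ‖iteratedFDeriv ℝ p (f ∘ T) k‖ ≤ _
  rw [T.iteratedFDeriv_comp_right hf k (by exact_mod_cast le_top)]
  refine (ContinuousMultilinearMap.norm_compContinuousLinearMap_le _ _).trans ?_
  rw [Finset.prod_const, Finset.card_univ, Fintype.card_fin, dilatePoly, Polynomial.eval_mul,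
    Polynomial.eval_C]
  calc ‖iteratedFDeriv ℝ p f (T k)‖ * ‖T‖ ^ p ≤ (M * Λ ^ (α - p) * (Q p).eval x) * ‖T‖ ^ p := by
        gcongr; exact h p
    _ = _ := by ring

end ScaleBound

/-! ### The two terms of the flow equation -/

/-- The linear map `k ↦ k_S`. -/
def partialSum {n : ℕ} (S : Finset (Fin n)) : (Fin n → Mom) →L[ℝ] Mom :=
  ∑ i ∈ S, ContinuousLinearMap.proj i

theorem partialSum_apply {n : ℕ} (S : Finset (Fin n)) (k : Fin n → Mom) :
    partialSum S k = ∑ i ∈ S, k i := by simp [partialSum]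

/-- The linear map `k ↦ ((k_i)_{i ∈ S}, T k)`. -/
def subMomCLM {n : ℕ} (S : Finset (Fin n)) (T : (Fin n → Mom) →L[ℝ] Mom) :
    (Fin n → Mom) →L[ℝ] (Fin (S.card + 1) → Mom) :=
  ContinuousLinearMap.pi (Fin.snoc (α := fun _ => (Fin n → Mom) →L[ℝ] Mom)
    (fun i => ContinuousLinearMap.proj (S.orderEmbOfFin rfl i)) T)

theorem subMomCLM_apply {n : ℕ} (S : Finset (Fin n)) (T : (Fin n → Mom) →L[ℝ] Mom)
    (k : Fin n → Mom) : subMomCLM S T k = subMom S k (T k) := by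
  funext i
  refine Fin.lastCases ?_ (fun j => ?_) i <;> simp [subMomCLM, subMom]

/-- The linear map `(k, q) ↦ (k, q, -q)`. -/
def loopMomCLM (n : ℕ) : ((Fin n → Mom) × Mom) →L[ℝ] (Fin (n + 2) → Mom) :=
  ContinuousLinearMap.pi (Fin.snoc (α := fun _ => ((Fin n → Mom) × Mom) →L[ℝ] Mom)
    (Fin.snoc (α := fun _ => ((Fin n → Mom) × Mom) →L[ℝ] Mom)
      (fun i => (ContinuousLinearMap.proj i).comp (ContinuousLinearMap.fst ℝ _ _))
      (ContinuousLinearMap.snd ℝ _ _)) (-ContinuousLinearMap.snd ℝ _ _))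

theorem loopMomCLM_apply {n : ℕ} (x : (Fin n → Mom) × Mom) : loopMomCLM n x =
    Fin.snoc (α := fun _ => Mom) (Fin.snoc (α := fun _ => Mom) x.1 x.2) (-x.2) := by
  funext i
  refine Fin.lastCases ?_ (fun j => ?_) i
  · simp [loopMomCLM]
  · refine Fin.lastCases ?_ (fun l => ?_) j <;> simp [loopMomCLM]

theorem conserved_subMom_iff {n : ℕ} (S : Finset (Fin n)) (k : Fin n → Mom) (q : Mom) :
    Conserved (subMom S k q) ↔ ∑ i ∈ S, k i + q = 0 := by
  have : ∑ i, k (S.orderEmbOfFin rfl i) = ∑ i ∈ S, k i := by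
    conv_rhs => rw [← Finset.map_orderEmbOfFin_univ S rfl]
    rw [Finset.sum_map]; rfl
  simp [Conserved, subMom, Fin.sum_univ_castSucc, this]

theorem conserved_subMom_neg {n : ℕ} (S : Finset (Fin n)) (k : Fin n → Mom) :
    Conserved (subMom S k (-∑ i ∈ S, k i)) := by
  rw [conserved_subMom_iff, add_neg_cancel]

theorem conserved_subMom_compl {n : ℕ} (S : Finset (Fin n)) {k : Fin n → Mom} (hk : Conserved k) :
    Conserved (subMom Sᶜ k (∑ i ∈ S, k i)) := by
  rw [conserved_subMom_iff, Finset.sum_compl_add_sum]; exact hk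

theorem conserved_loopMom {n : ℕ} {k : Fin n → Mom} (hk : Conserved k) (q : Mom) :
    Conserved (Fin.snoc (α := fun _ => Mom) (Fin.snoc (α := fun _ => Mom) k q) (-q)) := by
  have : ∑ i, k i = 0 := hk
  simp [Conserved, Fin.sum_univ_castSucc, this]

theorem norm_subMom_le {n : ℕ} (S : Finset (Fin n)) {k : Fin n → Mom} {q : Mom} {c : ℝ}
    (hc : 0 ≤ c) (hk : ‖k‖ ≤ c) (hq : ‖q‖ ≤ c) : ‖subMom S k q‖ ≤ c := by
  rw [pi_norm_le_iff_of_nonneg hc]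
  intro i
  refine Fin.lastCases ?_ (fun j => ?_) i
  · simpa [subMom] using hq
  · simpa [subMom] using (norm_le_pi_norm k _).trans hk

theorem norm_loopMom_le {n : ℕ} {k : Fin n → Mom} {q : Mom} {c : ℝ}
    (hc : 0 ≤ c) (hk : ‖k‖ ≤ c) (hq : ‖q‖ ≤ c) :
    ‖(Fin.snoc (α := fun _ => Mom) (Fin.snoc (α := fun _ => Mom) k q) (-q) : Fin (n + 2) → Mom)‖
      ≤ c := by
  rw [pi_norm_le_iff_of_nonneg hc]
  intro i
  refine Fin.lastCases ?_ (fun j => ?_) i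
  · simpa using hq
  · refine Fin.lastCases ?_ (fun l => ?_) j
    · simpa using hq
    · simpa using (norm_le_pi_norm k _).trans hk

/-- The tree term of the flow equation: two vertices joined by a differentiated propagator. -/
def treeTerm (K : ℝ → ℝ) (B Λ : ℝ) {n : ℕ} (S : Finset (Fin n))
    (f : (Fin (S.card + 1) → Mom) → ℝ) (g : (Fin (Sᶜ.card + 1) → Mom) → ℝ) (k : Fin n → Mom) : ℝ :=
  dPropagator K B Λ (∑ i ∈ S, k i) * f (subMom S k (-∑ i ∈ S, k i)) *
    g (subMom Sᶜ k (∑ i ∈ S, k i))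

/-- The loop term of the flow equation: a vertex closed by a differentiated propagator. -/
def loopTerm (K : ℝ → ℝ) (B Λ : ℝ) {n : ℕ} (f : (Fin (n + 2) → Mom) → ℝ) (k : Fin n → Mom) : ℝ :=
  ∫ q : Mom, f (Fin.snoc (α := fun _ => Mom) (Fin.snoc (α := fun _ => Mom) k q) (-q)) *
    dPropagator K B Λ q

/-- The term with `A` is absent because the differentiated propagator vanishes at `0`. -/
theorem polchinskiRHS_eq {K : ℝ → ℝ} (hK : IsCutoff K) (A B : ℝ) {Λ : ℝ} (hΛ : 0 < Λ)
    (L : VertexFunctions) (n : ℕ) (r : PertOrder) (k : Fin n → Mom) :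
    polchinskiRHS K A B Λ L n r k =
      - (1 / 2) * (∑ S : Finset (Fin n), ∑ s ∈ Finset.Iic r,
        treeTerm K B Λ S (L (S.card + 1) s) (L (Sᶜ.card + 1) (r - s)) k) +
      - (1 / 2) * (1 / (2 * Real.pi) ^ 4) * loopTerm K B Λ (L (n + 2) r) k := by
  rw [polchinskiRHS, dPropagator_zero hK B hΛ, mul_zero, sub_zero, sub_eq_add_neg, ← neg_mul,
    ← neg_mul]
  rfl

section Terms

variable {K : ℝ → ℝ} {B Λ : ℝ} {n : ℕ}

theorem treeTerm_eq (S : Finset (Fin n)) (f : (Fin (S.card + 1) → Mom) → ℝ)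
    (g : (Fin (Sᶜ.card + 1) → Mom) → ℝ) : treeTerm K B Λ S f g = fun k =>
      dPropagator K B Λ (partialSum S k) * f (subMomCLM S (-partialSum S) k) *
        g (subMomCLM Sᶜ (partialSum S) k) := by
  funext k
  simp [treeTerm, subMomCLM_apply, partialSum_apply]

theorem loopTerm_eq (f : (Fin (n + 2) → Mom) → ℝ) : loopTerm K B Λ f = fun k =>
      ∫ q, dPropagator K B Λ q • f (loopMomCLM n (k, q)) := by
  funext k
  simp only [loopTerm, loopMomCLM_apply, smul_eq_mul, mul_comm]

theorem contDiff_treeTerm (hK : IsCutoff K) (hΛ : 0 < Λ) (hB : |B| ≤ Λ ^ 2) (S : Finset (Fin n))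
    {f : (Fin (S.card + 1) → Mom) → ℝ} (hf : ContDiff ℝ ∞ f)
    {g : (Fin (Sᶜ.card + 1) → Mom) → ℝ} (hg : ContDiff ℝ ∞ g) :
    ContDiff ℝ ∞ (treeTerm K B Λ S f g) := by
  rw [treeTerm_eq]
  exact (((contDiff_dPropagator hK hΛ hB).comp (partialSum S).contDiff).mul
    (hf.comp (subMomCLM S (-partialSum S)).contDiff)).mul
    (hg.comp (subMomCLM Sᶜ (partialSum S)).contDiff)

theorem contDiff_loopTerm (hK : IsCutoff K) (hΛ : 0 < Λ) (hB : |B| ≤ Λ ^ 2)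
    {f : (Fin (n + 2) → Mom) → ℝ} (hf : ContDiff ℝ ∞ f) :
    ContDiff ℝ ∞ (loopTerm K B Λ f) := by
  rw [loopTerm_eq]
  exact contDiff_infty.2 fun j => contDiff_integral_smul (contDiff_dPropagator hK hΛ hB).continuous
    (fun q hq => dPropagator_eq_zero hK B hΛ hq) j (hf.comp (loopMomCLM n).contDiff)

theorem contDiff_polchinskiRHS (hK : IsCutoff K) (A : ℝ) (hΛ : 0 < Λ) (hB : |B| ≤ Λ ^ 2)
    {L : VertexFunctions} (hL : ∀ n r, 1 ≤ n → ContDiff ℝ ∞ (L n r)) (n : ℕ) (r : PertOrder) :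
    ContDiff ℝ ∞ (polchinskiRHS K A B Λ L n r) := by
  rw [funext (polchinskiRHS_eq hK A B hΛ L n r)]
  exact (contDiff_const.mul (ContDiff.sum fun S _ => ContDiff.sum fun s _ =>
    contDiff_treeTerm hK hΛ hB S (hL _ _ (by omega)) (hL _ _ (by omega)))).add
    (contDiff_const.mul (contDiff_loopTerm hK hΛ hB (hL _ _ (by omega))))

/-- Power counting for tree terms. Where `k_S` lies outside the region on which the vertices are
controlled, the propagator vanishes. -/
theorem scaleBound_treeTerm (hK : IsCutoff K) (S : Finset (Fin n)) {Q Q' : ℕ → Polynomial ℝ}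
    (hQ : ∀ p, IsPln (Q p)) (hQ' : ∀ p, IsPln (Q' p)) :
    ∃ R : ℕ → Polynomial ℝ, (∀ p, IsPln (R p)) ∧ ∀ {B Λ M M' x : ℝ} {α β : ℤ}, 0 < Λ →
      |B| ≤ Λ ^ 2 → 0 ≤ M → 0 ≤ M' → 0 ≤ x →
      ∀ {f : (Fin (S.card + 1) → Mom) → ℝ} {g : (Fin (Sᶜ.card + 1) → Mom) → ℝ},
      ContDiff ℝ ∞ f → ContDiff ℝ ∞ g →
      (∀ k ∈ region (S.card + 1) Λ, ScaleBound f k Λ M α x Q) →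
      (∀ k ∈ region (Sᶜ.card + 1) Λ, ScaleBound g k Λ M' β x Q') →
      ∀ k ∈ region n Λ, ScaleBound (treeTerm K B Λ S f g) k Λ (M * M') (α + β - 3) x R := by
  choose C hC0 hC using dPropagator_bound hK
  have hQC : ∀ p, IsPln (Polynomial.C (C p)) := fun p => IsPln.C (hC0 p)
  set R₁ := leibnizPoly (dilatePoly ‖partialSum S‖ fun p => Polynomial.C (C p))
    (dilatePoly ‖subMomCLM S (-partialSum S)‖ Q) with hR₁
  have hR₀ : ∀ p, IsPln (dilatePoly ‖partialSum S‖ (fun p => Polynomial.C (C p)) p) :=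
    isPln_dilatePoly (norm_nonneg _) hQC
  have hR₁' : ∀ p, IsPln (R₁ p) :=
    isPln_leibnizPoly hR₀ (isPln_dilatePoly (norm_nonneg _) hQ)
  have hR : ∀ p, IsPln (leibnizPoly R₁ (dilatePoly ‖subMomCLM Sᶜ (partialSum S)‖ Q') p) :=
    isPln_leibnizPoly hR₁' (isPln_dilatePoly (norm_nonneg _) hQ')
  refine ⟨_, hR, fun {B Λ M M' x α β} hΛ hB hM hM' hx f g hf hg hfb hgb k hk => ?_⟩
  rw [treeTerm_eq]
  have hk' := (mem_region_iff hΛ).1 hk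
  have hd := contDiff_dPropagator hK hΛ hB
  rcases le_or_gt ‖partialSum S k‖ (2 * Λ) with h | h
  · have b1 : ScaleBound (dPropagator K B Λ) (partialSum S k) Λ 1 (-3) x
        (fun p => Polynomial.C (C p)) := fun p => by
      rw [one_mul, Polynomial.eval_C]; exact hC p B Λ hΛ hB _ h
    have b2 := hfb (subMomCLM S (-partialSum S) k) (by
      rw [mem_region_iff hΛ, subMomCLM_apply, neg_apply, partialSum_apply]
      refine ⟨conserved_subMom_neg S k, norm_subMom_le S (by positivity) hk'.2 ?_⟩
      rwa [norm_neg, ← partialSum_apply])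
    have b3 := hgb (subMomCLM Sᶜ (partialSum S) k) (by
      rw [mem_region_iff hΛ, subMomCLM_apply, partialSum_apply]
      refine ⟨conserved_subMom_compl S hk'.1, norm_subMom_le _ (by positivity) hk'.2 ?_⟩
      rwa [← partialSum_apply])
    have d1 := hd.comp (partialSum S).contDiff
    have d2 := hf.comp (subMomCLM S (-partialSum S)).contDiff
    have d3 := hg.comp (subMomCLM Sᶜ (partialSum S)).contDiff
    have e1 := (b1.comp_clm hd (partialSum S)).mul hΛ zero_le_one hx hR₀ d1 d2
      (b2.comp_clm hf (subMomCLM S (-partialSum S)))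
    have e2 := e1.mul hΛ (by positivity) hx hR₁' (d1.mul d2) d3
      (b3.comp_clm hg (subMomCLM Sᶜ (partialSum S)))
    rw [one_mul, show -3 + α + β = α + β - 3 by ring] at e2
    exact e2
  · refine scaleBound_of_eventuallyEq_zero ?_ hΛ (by positivity) hx hR
    have : ∀ᶠ l in nhds k, 2 * Λ < ‖partialSum S l‖ :=
      ((partialSum S).continuous.norm.continuousAt).eventually (lt_mem_nhds h)
    filter_upwards [this] with l hl
    rw [dPropagator_eq_zero hK B hΛ hl, zero_mul, zero_mul]

/-- Power counting for loop terms: the propagator and the loop integral over a ball of radius `2 Λ`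
contribute `Λ⁻³ Λ⁴`. -/
theorem scaleBound_loopTerm (hK : IsCutoff K) (n : ℕ) {Q : ℕ → Polynomial ℝ}
    (hQ : ∀ p, IsPln (Q p)) :
    ∃ R : ℕ → Polynomial ℝ, (∀ p, IsPln (R p)) ∧ ∀ {B Λ M x : ℝ} {α : ℤ}, 0 < Λ →
      |B| ≤ Λ ^ 2 → ∀ {f : (Fin (n + 2) → Mom) → ℝ}, ContDiff ℝ ∞ f →
      (∀ k ∈ region (n + 2) Λ, ScaleBound f k Λ M α x Q) →
      ∀ k ∈ region n Λ, ScaleBound (loopTerm K B Λ f) k Λ M (α + 1) x R := by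
  obtain ⟨C, hC0, hC⟩ := dPropagator_bound hK 0
  set T := (loopMomCLM n).comp (ContinuousLinearMap.inl ℝ (Fin n → Mom) Mom) with hT
  set V := MeasureTheory.volume.real (Metric.closedBall (0 : Mom) 2) with hV
  have hV0 : 0 ≤ V := MeasureTheory.measureReal_nonneg
  refine ⟨fun p => Polynomial.C (C * V * ‖T‖ ^ p) * Q p,
    fun p => (IsPln.C (by positivity)).mul (hQ p), fun {B Λ M x α} hΛ hB f hf hfb k hk p => ?_⟩
  have hk' := (mem_region_iff hΛ).1 hk
  have hd := contDiff_dPropagator hK hΛ hB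
  rw [loopTerm_eq]
  have hq : ∀ q : Mom, ‖q‖ ≤ 2 * Λ →
      ‖iteratedFDeriv ℝ p (fun k => f (loopMomCLM n (k, q))) k‖ ≤
        M * Λ ^ (α - p) * (dilatePoly ‖T‖ Q p).eval x := by
    intro q hq
    have e : (fun k => f (loopMomCLM n (k, q))) =
        fun k => (fun l => f (l + loopMomCLM n (0, q))) (T k) := by
      funext l
      simp only [hT, ContinuousLinearMap.comp_apply, ContinuousLinearMap.inl_apply, ← map_add]
      simp
    rw [e]
    refine ScaleBound.comp_clm (f := fun l => f (l + loopMomCLM n (0, q)))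
      (hf.comp (contDiff_id.add contDiff_const)) T (fun p => ?_) p
    rw [iteratedFDeriv_comp_add_right]
    refine hfb _ ?_ p
    simp only [hT, ContinuousLinearMap.comp_apply, ContinuousLinearMap.inl_apply, ← map_add]
    rw [mem_region_iff hΛ, loopMomCLM_apply]
    simp only [Prod.mk_add_mk, add_zero, zero_add]
    exact ⟨conserved_loopMom hk'.1 q, norm_loopMom_le (by positivity) hk'.2 hq⟩
  refine (norm_iteratedFDeriv_integral_smul_le (F := fun y => f (loopMomCLM n y)) hd.continuous
    (fun q hq => dPropagator_eq_zero hK B hΛ hq)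
    (c := Λ ^ (-3 : ℤ) * C) (fun q hq => by simpa using hC B Λ hΛ hB q hq) p
    (hf.comp (loopMomCLM n).contDiff) hq).trans (le_of_eq ?_)
  rw [volume_real_closedBall_two_mul hΛ]
  simp only [dilatePoly, Polynomial.eval_mul, Polynomial.eval_C]
  have e : Λ ^ (α + 1 - p) = Λ ^ (-3 : ℤ) * Λ ^ (α - p) * Λ ^ 4 := by
    rw [← zpow_natCast, ← zpow_add₀ hΛ.ne', ← zpow_add₀ hΛ.ne']
    congr 1; push_cast; ring
  rw [e]
  ring

end Terms

/-! ### Integrating the flow -/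

theorem zpow_le_zpow_left_of_nonpos {a b : ℝ} (ha : 0 < a) (hab : a ≤ b) {e : ℤ} (he : e ≤ 0) :
    b ^ e ≤ a ^ e := by
  obtain ⟨m, rfl⟩ := Int.eq_ofNat_of_zero_le (neg_nonneg.2 he)|>.imp fun m h => neg_eq_iff_eq_neg.1
    h
  rw [zpow_neg, zpow_neg, zpow_natCast, zpow_natCast]
  gcongr

theorem zpow_le_zpow_left_of_nonneg {a b : ℝ} (ha : 0 < a) (hab : a ≤ b) {e : ℤ} (he : 0 ≤ e) :
    a ^ e ≤ b ^ e := by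
  lift e to ℕ using he
  rw [zpow_natCast, zpow_natCast]
  gcongr

theorem abs_sub_le_log_of_deriv_le {φ φ' : ℝ → ℝ} {a b : ℝ} (ha : 0 < a) (hab : a ≤ b) {C : ℝ}
    (h : ∀ x ∈ Set.Icc a b, HasDerivWithinAt φ (φ' x) (Set.Icc a b) x)
    (hC : ∀ x ∈ Set.Icc a b, |φ' x| ≤ C / x) : |φ b - φ a| ≤ C * Real.log (b / a) := by
  have key := image_norm_le_of_norm_deriv_right_le_deriv_boundary' (f := fun x => φ x - φ a)
    (f' := φ') (a := a) (b := b) (B := fun x => C * (Real.log x - Real.log a))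
    (B' := fun x => C / x)
    (fun x hx => ((h x hx).continuousWithinAt).sub continuousWithinAt_const)
    (fun x hx => (((h x (Set.Ico_subset_Icc_self hx)).sub_const _).mono_of_mem_nhdsWithin
      (Filter.mem_of_superset (Icc_mem_nhdsGE hx.2)
        (Set.Icc_subset_Icc_left hx.1))))
    (by simp)
    (fun x hx => ((continuousAt_const.mul ((Real.continuousAt_log
      (ha.trans_le hx.1).ne').sub continuousAt_const))).continuousWithinAt)
    (fun x hx => by
      have := ((Real.hasDerivAt_log (ha.trans_le hx.1).ne').sub_const (Real.log a)).const_mul C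
      exact this.hasDerivWithinAt)
    (fun x hx => hC x (Set.Ico_subset_Icc_self hx)) (Set.right_mem_Icc.2 hab)
  rw [Real.log_div (ha.trans_le hab).ne' ha.ne']
  exact key

/-- The polynomials produced by integrating the flow, from those `Qb` of the bounds at the bare
scale and `Qc` of the bounds on the right-hand side of the flow equation. For `n + p ≥ 6` the flow
is
integrated downwards from the bare scale; for `n + p < 6` it is integrated upwards from the
renormalization scale at zero momentum, and non-zero momenta are reached with the derivatives of
order `p + 1`. -/
def flowPoly (n : ℕ) (ρ : ℝ) (Qb Qc : ℕ → Polynomial ℝ) (p : ℕ) : Polynomial ℝ :=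
  if 6 ≤ n + p then Qb p + Qc p * Polynomial.X
  else Qc p + Polynomial.C (2 ^ p * (4 * n) ^ (p + 1) * ρ) * flowPoly n ρ Qb Qc (p + 1)
termination_by 6 - (n + p)

theorem isPln_flowPoly {n : ℕ} {ρ : ℝ} (hρ : 0 ≤ ρ) {Qb Qc : ℕ → Polynomial ℝ}
    (hQb : ∀ p, IsPln (Qb p)) (hQc : ∀ p, IsPln (Qc p)) (p : ℕ) :
    IsPln (flowPoly n ρ Qb Qc p) := by
  rw [flowPoly]
  split_ifs with h
  · exact (hQb p).add ((hQc p).mul IsPln.X)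
  · exact (hQc p).add ((IsPln.C (by positivity)).mul (isPln_flowPoly hρ hQb hQc (p + 1)))
termination_by 6 - (n + p)

/-- Integration of a flow equation with right-hand side of momentum dimension `5 - n`, with boundary
conditions at the bare scale for `n + p ≥ 6` and at the renormalization scale for `n + p < 6`. The
ratio
`ρ` of the momenta to the running scale is arbitrary; with `M = 0` this is a uniqueness statement on
the whole hyperplane. -/
theorem flow_estimate {n : ℕ} (hn : 1 ≤ n) {ρ : ℝ} (hρ : 0 ≤ ρ) {Qb Qc : ℕ → Polynomial ℝ}
    (hQc : ∀ p, IsPln (Qc p)) (hQb : ∀ p, IsPln (Qb p)) {ΛR Λ0 M : ℝ} (hR : 0 < ΛR) (hM : 0 ≤ M)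
    {G R : ℝ → (Fin n → Mom) → ℝ} (hG : ∀ Λ ∈ Set.Icc ΛR Λ0, ContDiff ℝ ∞ (G Λ))
    (hflow : ∀ Λ ∈ Set.Icc ΛR Λ0, ∀ (p : ℕ) (a : Fin p → Fin n × Fin n × Fin 4) (k : Fin n → Mom),
      Conserved k → HasDerivWithinAt (fun l => momDeriv a (G l) k) (momDeriv a (R Λ) k)
        (Set.Icc ΛR Λ0) Λ)
    (hRHS : ∀ Λ ∈ Set.Icc ΛR Λ0, ∀ (p : ℕ) (a : Fin p → Fin n × Fin n × Fin 4),
      ∀ k ∈ momBall n (ρ * Λ), |momDeriv a (R Λ) k| ≤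
        M * Λ ^ (5 - n - p : ℤ) * (Qc p).eval (Real.log (Λ0 / ΛR)))
    (hbare : ∀ p : ℕ, 6 ≤ n + p → ∀ a : Fin p → Fin n × Fin n × Fin 4,
      ∀ k ∈ momBall n (ρ * Λ0), |momDeriv a (G Λ0) k| ≤
        M * Λ0 ^ (6 - n - p : ℤ) * (Qb p).eval (Real.log (Λ0 / ΛR)))
    (hren : ∀ p : ℕ, n + p < 6 → ∀ a : Fin p → Fin n × Fin n × Fin 4, momDeriv a (G ΛR) 0 = 0)
    (p : ℕ) : ∀ Λ ∈ Set.Icc ΛR Λ0, ∀ (a : Fin p → Fin n × Fin n × Fin 4),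
      ∀ k ∈ momBall n (ρ * Λ), |momDeriv a (G Λ) k| ≤
        M * Λ ^ (6 - n - p : ℤ) * (flowPoly n ρ Qb Qc p).eval (Real.log (Λ0 / ΛR)) := by
  intro Λ hΛ a k hk
  have hΛ0 : 0 < Λ := hR.trans_le hΛ.1
  have hx : 0 ≤ Real.log (Λ0 / ΛR) :=
    Real.log_nonneg ((one_le_div hR).2 (hΛ.1.trans hΛ.2))
  have hc := (hQc p).eval_nonneg hx
  have hb := (hQb p).eval_nonneg hx
  have hpow : ∀ l : ℝ, 0 < l → l ^ (6 - n - p : ℤ) = l ^ (5 - n - p : ℤ) * l := fun l hl => by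
    rw [← zpow_add_one₀ hl.ne']; congr 1; ring
  rw [flowPoly]
  split_ifs with h
  · have he : (6 - n - p : ℤ) ≤ 0 := by omega
    have h1 := abs_sub_le_log_of_deriv_le (φ := fun l => momDeriv a (G l) k)
      (φ' := fun l => momDeriv a (R l) k) hΛ0 hΛ.2
      (C := M * Λ ^ (6 - n - p : ℤ) * (Qc p).eval (Real.log (Λ0 / ΛR)))
      (fun l hl => (hflow l ⟨hΛ.1.trans hl.1, hl.2⟩ p a k hk.1).mono
        (Set.Icc_subset_Icc_left hΛ.1))
      (fun l hl => by
        have hl0 : 0 < l := hΛ0.trans_le hl.1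
        refine (hRHS l ⟨hΛ.1.trans hl.1, hl.2⟩ p a k
          (momBall_mono (mul_le_mul_of_nonneg_left hl.1 hρ) hk)).trans ?_
        rw [le_div_iff₀ hl0, mul_right_comm, mul_assoc M, ← hpow l hl0]
        gcongr
        exact zpow_le_zpow_left_of_nonpos hΛ0 hl.1 he)
    have h2 := hbare p h a k (momBall_mono (mul_le_mul_of_nonneg_left hΛ.2 hρ) hk)
    have h3 : Real.log (Λ0 / Λ) ≤ Real.log (Λ0 / ΛR) := by
      have : 0 < Λ0 := hΛ0.trans_le hΛ.2
      have := hΛ.1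
      gcongr
    have h4 := zpow_le_zpow_left_of_nonpos hΛ0 hΛ.2 he
    have h5 : |momDeriv a (G Λ) k| ≤ |momDeriv a (G Λ0) k| +
        |momDeriv a (G Λ0) k - momDeriv a (G Λ) k| := by
      have := abs_sub_abs_le_abs_sub (momDeriv a (G Λ) k) (momDeriv a (G Λ0) k)
      rw [abs_sub_comm] at this
      linarith
    refine h5.trans ((add_le_add h2 h1).trans ?_)
    rw [Polynomial.eval_add, Polynomial.eval_mul, Polynomial.eval_X, mul_add, ← mul_assoc]
    gcongr
  · have he : (0 : ℤ) ≤ 5 - n - p := by omega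
    have h0 : ∀ b : Fin p → Fin n × Fin n × Fin 4, |momDeriv b (G Λ) 0| ≤
        M * Λ ^ (6 - n - p : ℤ) * (Qc p).eval (Real.log (Λ0 / ΛR)) := by
      intro b
      have h1 := (convex_Icc ΛR Λ).norm_image_sub_le_of_norm_hasDerivWithin_le
        (f := fun l => momDeriv b (G l) 0) (f' := fun l => momDeriv b (R l) 0)
        (C := M * Λ ^ (5 - n - p : ℤ) * (Qc p).eval (Real.log (Λ0 / ΛR)))
        (fun l hl => (hflow l ⟨hl.1, hl.2.trans hΛ.2⟩ p b 0 (conserved_zero n)).mono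
          (Set.Icc_subset_Icc_right hΛ.2))
        (fun l hl => by
          have hl0 : 0 < l := hR.trans_le hl.1
          refine (hRHS l ⟨hl.1, hl.2.trans hΛ.2⟩ p b 0
            (zero_mem_momBall n (by positivity))).trans ?_
          gcongr
          exact zpow_le_zpow_left_of_nonneg hl0 hl.2 he)
        (Set.left_mem_Icc.2 hΛ.1) (Set.right_mem_Icc.2 hΛ.1)
      rw [hren p (by omega) b, sub_zero] at h1
      refine h1.trans ?_
      rw [Real.norm_of_nonneg (sub_nonneg.2 hΛ.1)]
      have h2 : Λ - ΛR ≤ Λ := by linarith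
      have h3 : 0 ≤ M * Λ ^ (5 - n - p : ℤ) * (Qc p).eval (Real.log (Λ0 / ΛR)) := by positivity
      refine (mul_le_mul_of_nonneg_left h2 h3).trans (le_of_eq ?_)
      rw [hpow Λ hΛ0]
      ring
    have hstep := flow_estimate hn hρ hQc hQb hR hM hG hflow hRHS hbare hren (p + 1) Λ hΛ
    refine (momDeriv_le_of_zero hn (hG Λ hΛ) (mul_nonneg hρ hΛ0.le) hstep h0 a hk).trans (le_of_eq
      ?_)
    rw [Polynomial.eval_add, Polynomial.eval_mul, Polynomial.eval_C, hpow Λ hΛ0,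
      show (6 - n - (p + 1 : ℕ) : ℤ) = 5 - n - p by push_cast; ring]
    ring
termination_by 6 - (n + p)

/-! ### The renormalization scale -/

theorem momDeriv_sub {n p : ℕ} {f g : (Fin n → Mom) → ℝ} (hf : ContDiff ℝ ∞ f)
    (hg : ContDiff ℝ ∞ g) (a : Fin p → Fin n × Fin n × Fin 4) (k : Fin n → Mom) :
    momDeriv a (f - g) k = momDeriv a f k - momDeriv a g k := by
  rw [momDeriv, iteratedFDeriv_sub_apply (hf.contDiffAt.of_le (by exact_mod_cast le_top))
    (hg.contDiffAt.of_le (by exact_mod_cast le_top))]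
  rfl

theorem momDeriv_sum_mul {ι : Type*} {n p : ℕ} {s : Finset ι} {c : ι → ℝ}
    {f : ι → (Fin n → Mom) → ℝ} (hf : ∀ i ∈ s, ContDiff ℝ ∞ (f i))
    (a : Fin p → Fin n × Fin n × Fin 4) (k : Fin n → Mom) :
    momDeriv a (fun y => ∑ i ∈ s, c i * f i y) k = ∑ i ∈ s, c i * momDeriv a (f i) k := by
  have hf' : ∀ i ∈ s, ContDiffAt ℝ p (f i) k := fun i hi =>
    (hf i hi).contDiffAt.of_le (by exact_mod_cast le_top)
  have e : (fun y => ∑ i ∈ s, c i * f i y) = ∑ i ∈ s, c i • f i := by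
    funext y; simp
  rw [momDeriv, e, iteratedFDeriv_sum_apply (f := fun i => c i • f i)
    (fun i hi => (hf' i hi).const_smul (c i)),
    sum_apply]
  refine Finset.sum_congr rfl fun i hi => ?_
  rw [iteratedFDeriv_const_smul_apply (hf' i hi)]
  rfl

theorem momDeriv_const_mul {n p : ℕ} (c : ℝ) {f : (Fin n → Mom) → ℝ} (hf : ContDiff ℝ ∞ f)
    (a : Fin p → Fin n × Fin n × Fin 4) (k : Fin n → Mom) :
    momDeriv a (fun y => c * f y) k = c * momDeriv a f k := by
  simpa using momDeriv_sum_mul (s := {()}) (c := fun _ => c) (f := fun _ => f) (fun _ _ => hf) a k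

/-- Odd derivatives of functions that are invariant under reflection vanish at zero momentum. -/
theorem momDeriv_zero_of_odd {n p : ℕ} (hn : 1 ≤ n) (hp : Odd p) {f : (Fin n → Mom) → ℝ}
    (hf : ContDiff ℝ ∞ f) (h : ∀ k, Conserved k → f (fun i => -k i) = f k)
    (a : Fin p → Fin n × Fin n × Fin 4) : momDeriv a f 0 = 0 := by
  have e : (fun k => hyperplaneExt f ((-1 : ℝ) • k)) = hyperplaneExt f := by
    funext k
    have := h _ (conserved_conservedProj hn k)
    rw [hyperplaneExt, neg_one_smul, map_neg]
    exact this
  have h1 := congrFun (iteratedFDeriv_comp_const_smul (i := p) (-1 : ℝ)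
    ((contDiff_hyperplaneExt hf).of_le (by exact_mod_cast le_top))) 0
  rw [e, smul_zero, hp.neg_one_pow] at h1
  have h2 : momDeriv a (hyperplaneExt f) 0 = -momDeriv a (hyperplaneExt f) 0 := by
    conv_lhs => rw [momDeriv, h1]
    simp [momDeriv]
  rw [← momDeriv_hyperplaneExt hf a (conserved_zero n)]
  linarith

theorem momDir_one (a : Fin 1 × Fin 1 × Fin 4) : momDir a = 0 := by
  rw [momDir, Subsingleton.elim a.1 a.2.1, sub_self]

theorem momDeriv_two {n : ℕ} (a : Fin 2 → Fin n × Fin n × Fin 4) (f : (Fin n → Mom) → ℝ)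
    (k : Fin n → Mom) :
    momDeriv a f k = fderiv ℝ (fderiv ℝ f) k (momDir (a 0)) (momDir (a 1)) := by
  rw [momDeriv, iteratedFDeriv_two_apply]

theorem momDir_two (a : Fin 2 × Fin 2 × Fin 4) :
    ∃ c : ℝ, momDir a = c • momDir (0, 1, a.2.2) := by
  obtain ⟨i, j, μ⟩ := a
  fin_cases i <;> fin_cases j
  · exact ⟨0, by simp [momDir]⟩
  · exact ⟨1, by simp [momDir]⟩
  · exact ⟨-1, by simp [momDir]⟩
  · exact ⟨0, by simp [momDir]⟩

theorem momDir_eq_sub {n : ℕ} (i j l : Fin n) (μ : Fin 4) :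
    momDir (i, j, μ) = momDir (i, l, μ) - momDir (j, l, μ) := by
  simp [momDir]

theorem momDir_self {n : ℕ} (i : Fin n) (μ : Fin 4) : momDir (i, i, μ) = 0 := by
  simp [momDir]

/-- The renormalization and improvement conditions, together with `O(4)`-invariance, fix all
derivatives with `n + p ≤ 5` at zero momentum. -/
theorem momDeriv_zero_eq_of_conditions {L L' : VertexFunctions} {ρ₆ ρ₇ ρ₈ : PertOrder → ℝ}
    (hs : ∀ n r, 1 ≤ n → ContDiff ℝ ∞ (L n r)) (hs' : ∀ n r, 1 ≤ n → ContDiff ℝ ∞ (L' n r))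
    (hi : ∀ n r, 1 ≤ n → ∀ k, Conserved k → L n r (fun i => -k i) = L n r k)
    (hi' : ∀ n r, 1 ≤ n → ∀ k, Conserved k → L' n r (fun i => -k i) = L' n r k)
    (hR : RenormalizationConditions L) (hR' : RenormalizationConditions L')
    (hI : ImprovementConditions ρ₆ ρ₇ ρ₈ L) (hI' : ImprovementConditions ρ₆ ρ₇ ρ₈ L')
    {n p : ℕ} (hn : 1 ≤ n) (hnp : n + p < 6) (r : PertOrder)
    (a : Fin p → Fin n × Fin n × Fin 4) :
    momDeriv a (L n r) 0 = momDeriv a (L' n r) 0 := by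
  have zero_case : ∀ {n : ℕ} (a : Fin 0 → Fin n × Fin n × Fin 4) (f : (Fin n → Mom) → ℝ),
      momDeriv a f 0 = f 0 := fun a f => by rw [momDeriv, iteratedFDeriv_zero_apply]
  by_cases hodd : Odd p
  · rw [momDeriv_zero_of_odd hn hodd (hs n r hn) (hi n r hn),
      momDeriv_zero_of_odd hn hodd (hs' n r hn) (hi' n r hn)]
  by_cases hp0 : p = 0
  · subst hp0
    rw [zero_case, zero_case]
    obtain rfl | rfl | rfl | rfl | rfl : n = 1 ∨ n = 2 ∨ n = 3 ∨ n = 4 ∨ n = 5 := by omega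
    · rw [hR.rho₁, hR'.rho₁]
    · rw [hR.rho₂, hR'.rho₂]
    · rw [hR.rho₄, hR'.rho₄]
    · rw [hR.rho₅, hR'.rho₅]
    · rw [hI.rho₈, hI'.rho₈]
  by_cases hn1 : n = 1
  · subst hn1
    have : ∀ f : (Fin 1 → Mom) → ℝ, momDeriv a f 0 = 0 := fun f =>
      (iteratedFDeriv ℝ p f 0).map_coord_zero ⟨0, Nat.pos_of_ne_zero hp0⟩ (momDir_one _)
    rw [this, this]
  have hp2 : p = 2 := by
    have : p ≠ 1 := fun h => hodd (h ▸ odd_one)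
    have : p ≠ 3 := fun h => hodd (h ▸ (by decide))
    omega
  subst hp2
  obtain rfl | rfl : n = 2 ∨ n = 3 := by omega
  · have key : ∀ {L : VertexFunctions}, RenormalizationConditions L →
        momDeriv a (L 2 r) 0 = 0 := fun {L} hR => by
      obtain ⟨c, hc⟩ := momDir_two (a 0)
      obtain ⟨d, hd⟩ := momDir_two (a 1)
      have := hR.rho₃ r (a 0).2.2 (a 1).2.2
      rw [momDeriv_two] at this ⊢
      simp only [Matrix.cons_val_zero, Matrix.cons_val_one] at this
      rw [hc, hd, map_smul, map_smul, smul_apply, this, smul_zero, smul_zero]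
    rw [key hR, key hR']
  · have key : ∀ (i j : Fin 3) (μ ν : Fin 4),
        fderiv ℝ (fderiv ℝ (L 3 r)) 0 (momDir (i, 2, μ)) (momDir (j, 2, ν)) =
        fderiv ℝ (fderiv ℝ (L' 3 r)) 0 (momDir (i, 2, μ)) (momDir (j, 2, ν)) := fun i j μ ν => by
      by_cases hi2 : i = 2
      · rw [hi2, momDir_self]; simp
      by_cases hj2 : j = 2
      · rw [hj2, momDir_self]; simp
      have h : momDeriv ![(i, 2, μ), (j, 2, ν)] (L 3 r) 0 =
          momDeriv ![(i, 2, μ), (j, 2, ν)] (L' 3 r) 0 := by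
        by_cases hij : i = j
        · subst hij
          rw [hI.rho₆ r μ ν i hi2, hI'.rho₆ r μ ν i hi2]
        · rw [hI.rho₇ r μ ν i j hi2 hj2 hij, hI'.rho₇ r μ ν i j hi2 hj2 hij]
      simpa [momDeriv_two] using h
    rw [momDeriv_two, momDeriv_two]
    have e : ∀ b : Fin 3 × Fin 3 × Fin 4, momDir b =
        momDir (b.1, 2, b.2.2) - momDir (b.2.1, 2, b.2.2) := fun b => momDir_eq_sub _ _ _ _
    rw [e (a 0), e (a 1)]
    simp only [map_sub, sub_apply, key]

/-! ### Functions that are polynomials on the unit interval -/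

/-- `f` agrees on `[0, 1]` with a polynomial of degree at most `d`. -/
def PolyOn (d : ℕ) (f : ℝ → ℝ) : Prop :=
  ∃ P : Polynomial ℝ, P.natDegree ≤ d ∧ ∀ t ∈ Set.Icc (0 : ℝ) 1, f t = P.eval t

/-- The finite combination `∑ c(u) δ_u` of evaluations at points of `[0, 1]` annihilates all
polynomials of degree at most `d`. -/
def Annihilates (d : ℕ) (s : Finset ℝ) (c : ℝ → ℝ) : Prop :=
  (∀ u ∈ s, u ∈ Set.Icc (0 : ℝ) 1) ∧ ∀ P : Polynomial ℝ, P.natDegree ≤ d →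
    ∑ u ∈ s, c u * P.eval u = 0

theorem PolyOn.mul {d e : ℕ} {f g : ℝ → ℝ} (hf : PolyOn d f) (hg : PolyOn e g) :
    PolyOn (d + e) (fun t => f t * g t) := by
  obtain ⟨P, hP, h⟩ := hf
  obtain ⟨Q, hQ, h'⟩ := hg
  exact ⟨P * Q, Polynomial.natDegree_mul_le.trans (add_le_add hP hQ), fun t ht => by
    simp only [h t ht, h' t ht, Polynomial.eval_mul]⟩

theorem PolyOn.const_mul {d : ℕ} {f : ℝ → ℝ} (hf : PolyOn d f) (c : ℝ) :
    PolyOn d (fun t => c * f t) := by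
  obtain ⟨P, hP, h⟩ := hf
  exact ⟨Polynomial.C c * P, (Polynomial.natDegree_C_mul_le _ _).trans hP, fun t ht => by
    simp only [h t ht, Polynomial.eval_mul, Polynomial.eval_C]⟩

theorem PolyOn.add {d : ℕ} {f g : ℝ → ℝ} (hf : PolyOn d f) (hg : PolyOn d g) :
    PolyOn d (fun t => f t + g t) := by
  obtain ⟨P, hP, h⟩ := hf
  obtain ⟨Q, hQ, h'⟩ := hg
  exact ⟨P + Q, Polynomial.natDegree_add_le_of_degree_le hP hQ, fun t ht => by
    simp only [h t ht, h' t ht, Polynomial.eval_add]⟩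

theorem PolyOn.sum {ι : Type*} {s : Finset ι} {d : ℕ} {f : ι → ℝ → ℝ}
    (hf : ∀ i ∈ s, PolyOn d (f i)) : PolyOn d (fun t => ∑ i ∈ s, f i t) := by
  choose! P hP h using hf
  refine ⟨∑ i ∈ s, P i, Polynomial.natDegree_sum_le_of_forall_le _ _ hP, fun t ht => ?_⟩
  rw [Polynomial.eval_finsetSum]
  exact Finset.sum_congr rfl fun i hi => h i hi t ht

theorem Annihilates.sum_eq_zero {d : ℕ} {s : Finset ℝ} {c : ℝ → ℝ} (h : Annihilates d s c)
    {f : ℝ → ℝ} (hf : PolyOn d f) : ∑ u ∈ s, c u * f u = 0 := by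
  obtain ⟨P, hP, hfP⟩ := hf
  rw [← h.2 P hP]
  exact Finset.sum_congr rfl fun u hu => by rw [hfP u (h.1 u hu)]

/-- The interpolation nodes `j / d`, `j = 0, …, d`. -/
def nodes (d : ℕ) : Finset ℝ := (Finset.range (d + 1)).image fun j : ℕ => (j : ℝ) / d

theorem nodes_subset (d : ℕ) : ∀ u ∈ nodes d, u ∈ Set.Icc (0 : ℝ) 1 := by
  intro u hu
  obtain ⟨j, hj, rfl⟩ := Finset.mem_image.1 hu
  have : (j : ℝ) ≤ d := by exact_mod_cast Nat.lt_succ_iff.1 (Finset.mem_range.1 hj)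
  exact ⟨by positivity, div_le_one_of_le₀ this (by positivity)⟩

theorem card_nodes (d : ℕ) : (nodes d).card = d + 1 := by
  rcases Nat.eq_zero_or_pos d with rfl | hd
  · simp [nodes]
  rw [nodes, Finset.card_image_of_injective, Finset.card_range]
  intro i j hij
  have : (d : ℝ) ≠ 0 := by positivity
  have := (div_left_inj' this).1 hij
  exact_mod_cast this

theorem eq_interpolate_nodes {d : ℕ} {P : Polynomial ℝ} (hP : P.natDegree ≤ d) :
    P = ∑ u ∈ nodes d, Polynomial.C (P.eval u) * Lagrange.basis (nodes d) id u := by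
  have h := Lagrange.eq_interpolate (s := nodes d) (v := id) (f := P) Function.injective_id.injOn
    (by
    rw [card_nodes]
    refine lt_of_le_of_lt Polynomial.degree_le_natDegree ?_
    exact_mod_cast Nat.lt_succ_of_le hP)
  conv_lhs => rw [h]
  rw [Lagrange.interpolate_apply]
  rfl

theorem natDegree_basis_nodes {d : ℕ} {u : ℝ} (hu : u ∈ nodes d) :
    (Lagrange.basis (nodes d) id u).natDegree ≤ d := by
  have := Lagrange.degree_basis (v := (id : ℝ → ℝ)) Function.injective_id.injOn hu
  rw [card_nodes] at this
  exact Polynomial.natDegree_le_of_degree_le this.le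

theorem polyOn_of_annihilates {d : ℕ} {f : ℝ → ℝ}
    (h : ∀ s c, Annihilates d s c → ∑ u ∈ s, c u * f u = 0) : PolyOn d f := by
  refine ⟨∑ u ∈ nodes d, Polynomial.C (f u) * Lagrange.basis (nodes d) id u, ?_, fun t ht => ?_⟩
  · refine Polynomial.natDegree_sum_le_of_forall_le _ _ fun u hu => ?_
    exact (Polynomial.natDegree_C_mul_le _ _).trans (natDegree_basis_nodes hu)
  · have key : ∀ g : ℝ → ℝ, ∑ u ∈ insert t (nodes d), ((if u = t then 1 else 0) -
        if u ∈ nodes d then (Lagrange.basis (nodes d) id u).eval t else 0) * g u =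
        g t - ∑ u ∈ nodes d, (Lagrange.basis (nodes d) id u).eval t * g u := by
      intro g
      simp only [sub_mul, Finset.sum_sub_distrib, ite_mul, one_mul, zero_mul]
      congr 1
      · simp
      · rw [Finset.sum_ite_mem, Finset.inter_eq_right.2 (Finset.subset_insert _ _)]
    have h1 := h (insert t (nodes d)) _ ⟨fun u hu => by
      rcases Finset.mem_insert.1 hu with rfl | hu
      exacts [ht, nodes_subset d u hu], fun P hP => by
        rw [key, sub_eq_zero]
        conv_lhs => rw [eq_interpolate_nodes hP, Polynomial.eval_finsetSum]
        refine Finset.sum_congr rfl fun u _ => ?_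
        rw [Polynomial.eval_mul, Polynomial.eval_C, mul_comm]⟩
    rw [key, sub_eq_zero] at h1
    rw [h1, Polynomial.eval_finsetSum]
    refine Finset.sum_congr rfl fun u _ => ?_
    rw [Polynomial.eval_mul, Polynomial.eval_C, mul_comm]

/-- Interpolation makes polynomiality in `t` a finite linear condition, which passes through
integrals without any domination. -/
theorem polyOn_integral {d : ℕ} {f : ℝ → Mom → ℝ} (h : ∀ q, PolyOn d fun t => f t q)
    (hi : ∀ t ∈ Set.Icc (0 : ℝ) 1, MeasureTheory.Integrable (f t)) :
    PolyOn d fun t => ∫ q, f t q := by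
  refine polyOn_of_annihilates fun s c hs => ?_
  simp only [← MeasureTheory.integral_const_mul]
  rw [← MeasureTheory.integral_finsetSum _ fun u hu => (hi u (hs.1 u hu)).const_mul _]
  simp only [hs.sum_eq_zero (h _), MeasureTheory.integral_zero]

/-- An inequality of Markov type: on polynomials of bounded degree, the derivative is controlled by
the oscillation. -/
theorem exists_derivative_bound (d : ℕ) : ∃ C, 0 ≤ C ∧ ∀ (P : Polynomial ℝ) (b : ℝ),
    P.natDegree ≤ d →
    (∀ t ∈ Set.Icc (0 : ℝ) 1, ∀ t' ∈ Set.Icc (0 : ℝ) 1, |P.eval t - P.eval t'| ≤ b) →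
    ∀ t ∈ Set.Icc (0 : ℝ) 1, |P.derivative.eval t| ≤ C * b := by
  have hB : ∀ u : ℝ, ∃ C, ∀ t ∈ Set.Icc (0 : ℝ) 1,
      ‖(Lagrange.basis (nodes d) id u).derivative.eval t‖ ≤ C := fun u =>
    isCompact_Icc.exists_bound_of_continuousOn (Polynomial.continuous _).continuousOn
  choose C hC using hB
  have hC0 : ∀ u, 0 ≤ C u := fun u => (norm_nonneg _).trans (hC u 0 (by simp))
  refine ⟨∑ u ∈ nodes d, C u, Finset.sum_nonneg fun u _ => hC0 u, fun P b hP hb t ht => ?_⟩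
  have hb0 : 0 ≤ b := (abs_nonneg _).trans (hb t ht t ht)
  have hdeg : (P - Polynomial.C (P.eval 0)).natDegree ≤ d := by
    rwa [Polynomial.natDegree_sub_C]
  have e : P.derivative = ∑ u ∈ nodes d, Polynomial.C (P.eval u - P.eval 0) *
      (Lagrange.basis (nodes d) id u).derivative := by
    have h1 : P.derivative = (P - Polynomial.C (P.eval 0)).derivative := by simp
    rw [h1]
    conv_lhs => rw [eq_interpolate_nodes hdeg, Polynomial.derivative_sum]
    refine Finset.sum_congr rfl fun u _ => ?_
    rw [Polynomial.derivative_C_mul, Polynomial.eval_sub, Polynomial.eval_C]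
  rw [e, Polynomial.eval_finsetSum, Finset.sum_mul]
  refine (Finset.abs_sum_le_sum_abs _ _).trans (Finset.sum_le_sum fun u hu => ?_)
  rw [Polynomial.eval_mul, Polynomial.eval_C, abs_mul, mul_comm]
  gcongr
  · exact hC0 u
  · exact hC u t ht
  · exact hb u (nodes_subset d u hu) 0 (by simp)

/-! ### Families of flows -/

/-- The hypotheses on the family of flows, with the data that the polynomials may depend on first.
-/
structure IsBoundedFamily (K : ℝ → ℝ) (N : PertOrder → ℕ)
    (P P₀ : ℕ → ℕ → PertOrder → Polynomial ℝ) (ΛR Λ0 A B : ℝ) (L : ℝ → ℝ → VertexFunctions)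
    (ρ₆ ρ₇ ρ₈ : PertOrder → ℝ) : Prop where
  pos : 0 < ΛR
  le : ΛR ≤ Λ0
  abs_B_le : |B| ≤ ΛR ^ 2
  flow : ∀ t ∈ Set.Icc (0 : ℝ) 1, IsFlow K N A B ΛR Λ0 (L t)
  ren : ∀ t ∈ Set.Icc (0 : ℝ) 1, RenormalizationConditions (L t ΛR)
  imp : ∀ t ∈ Set.Icc (0 : ℝ) 1, ImprovementConditions ρ₆ ρ₇ ρ₈ (L t ΛR)
  bare : ∀ t ∈ Set.Icc (0 : ℝ) 1, ∀ (n p : ℕ) (r : PertOrder), 1 ≤ n → 6 ≤ n + p →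
    ∀ (a : Fin p → Fin n × Fin n × Fin 4) (k : Fin n → Mom), Conserved k →
      momDeriv a (dimless Λ0 (L t Λ0) n r) k = t * momDeriv a (dimless Λ0 (L 1 Λ0) n r) k
  bound : ∀ t ∈ Set.Icc (0 : ℝ) 1, ∀ Λ ∈ Set.Icc ΛR Λ0, ∀ (n p : ℕ) (r : PertOrder), 1 ≤ n →
    ∀ (a : Fin p → Fin n × Fin n × Fin 4), ∀ k ∈ region n Λ,
      |momDeriv a (dimless Λ (L t Λ) n r) k| ≤ powerBound ΛR Λ0 Λ p r (P n p r)
  bare_deriv : ∀ t ∈ Set.Icc (0 : ℝ) 1, ∀ (n p : ℕ) (r : PertOrder), 1 ≤ n → 6 ≤ n + p →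
    ∀ (a : Fin p → Fin n × Fin n × Fin 4), ∀ k ∈ region n Λ0,
      |derivWithin (fun τ => momDeriv a (dimless Λ0 (L τ Λ0) n r) k) (Set.Icc 0 1) t| ≤
        (Λ0 ^ p)⁻¹ * (Λ0 / ΛR) ^ (r 0) * (P₀ n p r).eval (Real.log (Λ0 / ΛR))

/-- The factor by which the bounds on the coefficients of order `r` differ from those of order `0`.
It
does not depend on the running scale, and it is multiplicative in `r`. -/
def orderScale (ΛR Λ0 : ℝ) (r : PertOrder) : ℝ := (ΛR ^ r 0)⁻¹ * Λ0 ^ ordNR r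

theorem orderScale_mul (ΛR Λ0 : ℝ) {s r : PertOrder} (h : s ≤ r) :
    orderScale ΛR Λ0 s * orderScale ΛR Λ0 (r - s) = orderScale ΛR Λ0 r := by
  have h0 : r 0 = s 0 + (r - s) 0 := (add_tsub_cancel_of_le (h 0)).symm
  have h1 : ordNR r = ordNR s + ordNR (r - s) := by
    have h2 : s 2 ≤ r 2 := h 2
    have h3 : s 3 ≤ r 3 := h 3
    have h4 : s 4 ≤ r 4 := h 4
    simp only [ordNR, Pi.sub_apply]
    omega
  rw [orderScale, orderScale, orderScale, h0, h1, pow_add, pow_add, mul_inv]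
  ring

theorem orderScale_nonneg {ΛR Λ0 : ℝ} (hR : 0 < ΛR) (h0 : ΛR ≤ Λ0) (r : PertOrder) :
    0 ≤ orderScale ΛR Λ0 r := by
  have : 0 ≤ Λ0 := hR.le.trans h0
  rw [orderScale]; positivity

theorem powerBound_eq {ΛR Λ0 Λ : ℝ} (hΛ : 0 < Λ) (n p : ℕ) (r : PertOrder)
    (Q : Polynomial ℝ) : powerBound ΛR Λ0 Λ p r Q =
      Λ ^ ((n : ℤ) - 4 + (r 0 : ℤ) - (ordNR r : ℤ)) *
        (orderScale ΛR Λ0 r * Λ ^ (4 - n - p : ℤ) * Q.eval (Real.log (Λ0 / ΛR))) := by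
  have e : Λ ^ ((n : ℤ) - 4 + (r 0 : ℤ) - (ordNR r : ℤ)) * Λ ^ (4 - n - p : ℤ) =
      (Λ ^ p)⁻¹ * Λ ^ r 0 * (Λ ^ ordNR r)⁻¹ := by
    rw [← zpow_add₀ hΛ.ne', ← zpow_natCast, ← zpow_natCast, ← zpow_natCast, ← zpow_neg, ← zpow_neg,
      ← zpow_add₀ hΛ.ne', ← zpow_add₀ hΛ.ne']
    congr 1; ring
  calc powerBound ΛR Λ0 Λ p r Q = ((Λ ^ p)⁻¹ * Λ ^ r 0 * (Λ ^ ordNR r)⁻¹) *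
        (orderScale ΛR Λ0 r * Q.eval (Real.log (Λ0 / ΛR))) := by
        rw [powerBound, orderScale, div_pow, div_pow]; ring
    _ = _ := by rw [← e]; ring

/-- The vertex functions, made constant in the direction transversal to the hyperplane of conserved
momenta. -/
def extVertex (L : VertexFunctions) : VertexFunctions := fun n r => hyperplaneExt (L n r)

theorem treeTerm_hyperplaneExt (K : ℝ → ℝ) (B Λ : ℝ) {n : ℕ} (S : Finset (Fin n))
    (f : (Fin (S.card + 1) → Mom) → ℝ) (g : (Fin (Sᶜ.card + 1) → Mom) → ℝ) {k : Fin n → Mom}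
    (hk : Conserved k) :
    treeTerm K B Λ S (hyperplaneExt f) (hyperplaneExt g) k = treeTerm K B Λ S f g k := by
  rw [treeTerm, treeTerm, hyperplaneExt_of_conserved _ (conserved_subMom_neg S k),
    hyperplaneExt_of_conserved _ (conserved_subMom_compl S hk)]

theorem loopTerm_hyperplaneExt (K : ℝ → ℝ) (B Λ : ℝ) {n : ℕ}
    (f : (Fin (n + 2) → Mom) → ℝ) {k : Fin n → Mom} (hk : Conserved k) :
    loopTerm K B Λ (hyperplaneExt f) k = loopTerm K B Λ f k := by
  simp only [loopTerm, hyperplaneExt_of_conserved _ (conserved_loopMom hk _)]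

theorem polchinskiRHS_extVertex {K : ℝ → ℝ} (hK : IsCutoff K) (A B : ℝ) {Λ : ℝ} (hΛ : 0 < Λ)
    (L : VertexFunctions) (n : ℕ) (r : PertOrder) {k : Fin n → Mom} (hk : Conserved k) :
    polchinskiRHS K A B Λ (extVertex L) n r k = polchinskiRHS K A B Λ L n r k := by
  simp only [polchinskiRHS_eq hK A B hΛ, extVertex, treeTerm_hyperplaneExt K B Λ _ _ _ hk,
    loopTerm_hyperplaneExt K B Λ _ hk]

theorem integrable_loop {K : ℝ → ℝ} (hK : IsCutoff K) {B Λ : ℝ} (hΛ : 0 < Λ) (hB : |B| ≤ Λ ^ 2)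
    {n : ℕ} {f : (Fin (n + 2) → Mom) → ℝ} (hf : ContDiff ℝ ∞ f) (k : Fin n → Mom) :
    MeasureTheory.Integrable fun q : Mom =>
      f (Fin.snoc (α := fun _ => Mom) (Fin.snoc (α := fun _ => Mom) k q) (-q)) *
        dPropagator K B Λ q := by
  have e : (fun q : Mom => f (Fin.snoc (α := fun _ => Mom)
      (Fin.snoc (α := fun _ => Mom) k q) (-q)) * dPropagator K B Λ q) =
      fun q => f (loopMomCLM n (k, q)) * dPropagator K B Λ q := by
    simp only [loopMomCLM_apply]
  rw [e]
  have hc := (contDiff_dPropagator hK hΛ hB).continuous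
  have hcomp : HasCompactSupport (dPropagator K B Λ) :=
    HasCompactSupport.of_support_subset_isCompact (isCompact_closedBall (0 : Mom) (2 * Λ))
      fun q hq => by
        by_contra h
        exact hq (dPropagator_eq_zero hK B hΛ (by simpa using h))
  have hf' := hf.continuous
  exact Continuous.integrable_of_hasCompactSupport (by fun_prop) hcomp.mul_left

/-- Induction over the orders of perturbation theory and, at each order, downwards in `n`. -/
theorem order_induction {N : PertOrder → ℕ} {C : PertOrder → ℕ → Prop}
    (h0 : ∀ n, 1 ≤ n → C 0 n) (hN : ∀ r n, 1 ≤ n → N r < n → C r n)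
    (step : ∀ r n, 1 ≤ n → r ≠ 0 → (∀ s < r, ∀ m, 1 ≤ m → C s m) → C r (n + 2) → C r n)
    (r : PertOrder) : ∀ n, 1 ≤ n → C r n := by
  induction r using WellFoundedLT.induction with
  | ind r ih =>
    by_cases hr : r = 0
    · exact hr ▸ h0
    have key : ∀ m n, 1 ≤ n → N r < n + m → C r n := by
      intro m
      induction m with
      | zero => exact fun n hn h => hN r n hn h
      | succ m ihm =>
        exact fun n hn h => step r n hn hr ih (ihm (n + 2) (by omega) (by omega))
    exact fun n hn => key (N r) n hn (by omega)

section Family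

variable {K : ℝ → ℝ} {N : PertOrder → ℕ} {P P₀ : ℕ → ℕ → PertOrder → Polynomial ℝ}
  {ΛR Λ0 A B : ℝ} {L : ℝ → ℝ → VertexFunctions} {ρ₆ ρ₇ ρ₈ : PertOrder → ℝ}

theorem IsBoundedFamily.log_nonneg (F : IsBoundedFamily K N P P₀ ΛR Λ0 A B L ρ₆ ρ₇ ρ₈) :
    0 ≤ Real.log (Λ0 / ΛR) := Real.log_nonneg ((one_le_div F.pos).2 F.le)

theorem IsBoundedFamily.scale_pos (F : IsBoundedFamily K N P P₀ ΛR Λ0 A B L ρ₆ ρ₇ ρ₈) {Λ : ℝ}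
    (hΛ : Λ ∈ Set.Icc ΛR Λ0) : 0 < Λ := F.pos.trans_le hΛ.1

theorem IsBoundedFamily.abs_le_sq (F : IsBoundedFamily K N P P₀ ΛR Λ0 A B L ρ₆ ρ₇ ρ₈) {Λ : ℝ}
    (hΛ : Λ ∈ Set.Icc ΛR Λ0) : |B| ≤ Λ ^ 2 :=
  F.abs_B_le.trans (pow_le_pow_left₀ F.pos.le hΛ.1 2)

theorem IsBoundedFamily.bare_eq (F : IsBoundedFamily K N P P₀ ΛR Λ0 A B L ρ₆ ρ₇ ρ₈) {t : ℝ}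
    (ht : t ∈ Set.Icc (0 : ℝ) 1) {n p : ℕ} (r : PertOrder) (hn : 1 ≤ n) (hnp : 6 ≤ n + p)
    (a : Fin p → Fin n × Fin n × Fin 4) {k : Fin n → Mom} (hk : Conserved k) :
    momDeriv a (L t Λ0 n r) k = t * momDeriv a (L 1 Λ0 n r) k := by
  have hΛ : Λ0 ∈ Set.Icc ΛR Λ0 := Set.right_mem_Icc.2 F.le
  have h := F.bare t ht n p r hn hnp a k hk
  have hz : Λ0 ^ ((n : ℤ) - 4 + (r 0 : ℤ) - (ordNR r : ℤ)) ≠ 0 :=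
    zpow_ne_zero _ (F.scale_pos hΛ).ne'
  have e : ∀ τ ∈ Set.Icc (0 : ℝ) 1, momDeriv a (dimless Λ0 (L τ Λ0) n r) k =
      Λ0 ^ ((n : ℤ) - 4 + (r 0 : ℤ) - (ordNR r : ℤ)) * momDeriv a (L τ Λ0 n r) k :=
    fun τ hτ => momDeriv_const_mul _ ((F.flow τ hτ).smooth Λ0 hΛ n r hn) a k
  rw [e t ht, e 1 (by simp), mul_left_comm] at h
  exact mul_left_cancel₀ hz h

theorem IsBoundedFamily.ren_eq (F : IsBoundedFamily K N P P₀ ΛR Λ0 A B L ρ₆ ρ₇ ρ₈) {t t' : ℝ}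
    (ht : t ∈ Set.Icc (0 : ℝ) 1) (ht' : t' ∈ Set.Icc (0 : ℝ) 1) {n p : ℕ} (r : PertOrder)
    (hn : 1 ≤ n) (hnp : n + p < 6) (a : Fin p → Fin n × Fin n × Fin 4) :
    momDeriv a (L t ΛR n r) 0 = momDeriv a (L t' ΛR n r) 0 := by
  have hΛ : ΛR ∈ Set.Icc ΛR Λ0 := Set.left_mem_Icc.2 F.le
  exact momDeriv_zero_eq_of_conditions ((F.flow t ht).smooth ΛR hΛ) ((F.flow t' ht').smooth ΛR hΛ)
    (fun n r hn k hk => (F.flow t ht).invariant ΛR hΛ n r hn (LinearIsometryEquiv.neg ℝ) k hk)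
    (fun n r hn k hk => (F.flow t' ht').invariant ΛR hΛ n r hn (LinearIsometryEquiv.neg ℝ) k hk)
    (F.ren t ht) (F.ren t' ht') (F.imp t ht) (F.imp t' ht') hn hnp r a

/-! ### Polynomial dependence on the parameter -/

/-- The coefficients of order `r` are polynomials in `t` of degree at most `r₁ + ⋯ + r₅`: this holds
for the boundary values, and the flow equation preserves it. -/
theorem IsBoundedFamily.polyOn (hK : IsCutoff K)
    (F : IsBoundedFamily K N P P₀ ΛR Λ0 A B L ρ₆ ρ₇ ρ₈) (r : PertOrder) : ∀ n, 1 ≤ n →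
    ∀ Λ ∈ Set.Icc ΛR Λ0, ∀ k, Conserved k → PolyOn (∑ i, r i) fun t => L t Λ n r k := by
  refine order_induction (N := N) (C := fun r n => ∀ Λ ∈ Set.Icc ΛR Λ0, ∀ k, Conserved k →
    PolyOn (∑ i, r i) fun t => L t Λ n r k) ?_ ?_ ?_ r
  · intro n hn Λ hΛ k hk
    exact ⟨0, by simp, fun t ht => by simpa using (F.flow t ht).order_zero Λ hΛ n hn k hk⟩
  · intro r n hn hN Λ hΛ k hk
    exact ⟨0, by simp, fun t ht => by simpa using (F.flow t ht).finite_order Λ hΛ n r hn hN k hk⟩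
  intro r n hn hr ih ih2 Λ hΛ k hk
  have hdeg : 1 ≤ ∑ i, r i := by
    by_contra h
    refine hr (funext fun i => ?_)
    have := Finset.single_le_sum (f := r) (fun i _ => Nat.zero_le _) (Finset.mem_univ i)
    simp only [Pi.zero_apply]
    omega
  refine polyOn_of_annihilates fun s c hs => ?_
  have hsmooth : ∀ u ∈ s, ∀ l ∈ Set.Icc ΛR Λ0, ∀ n r, 1 ≤ n → ContDiff ℝ ∞ (L u l n r) :=
    fun u hu l hl => (F.flow u (hs.1 u hu)).smooth l hl
  have hsmoothR : ∀ u ∈ s, ∀ l ∈ Set.Icc ΛR Λ0,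
      ContDiff ℝ ∞ (polchinskiRHS K A B l (L u l) n r) := fun u hu l hl =>
    contDiff_polchinskiRHS hK A (F.scale_pos hl) (F.abs_le_sq hl) (hsmooth u hu l hl) n r
  -- The right-hand side is polynomial in `t`; a tree term that could exceed the degree has a factor of
  -- order `0` and vanishes.
  have hRzero : ∀ l ∈ Set.Icc ΛR Λ0, ∀ k, Conserved k →
      ∑ u ∈ s, c u * polchinskiRHS K A B l (L u l) n r k = 0 := by
    intro l hl k hk
    refine hs.sum_eq_zero (f := fun u => polchinskiRHS K A B l (L u l) n r k) ?_
    simp only [polchinskiRHS_eq hK A B (F.scale_pos hl)]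
    refine ((PolyOn.sum fun S _ => PolyOn.sum fun σ hσ => ?_).const_mul _).add
      (PolyOn.const_mul ?_ _)
    · have hσr : σ ≤ r := Finset.mem_Iic.1 hσ
      by_cases h0 : σ = 0
      · refine ⟨0, by simp, fun t ht => ?_⟩
        dsimp only
        rw [treeTerm, h0, (F.flow t ht).order_zero l hl _ (by omega) _ (conserved_subMom_neg S k)]
        simp
      by_cases h1 : σ = r
      · refine ⟨0, by simp, fun t ht => ?_⟩
        dsimp only
        rw [treeTerm, h1, tsub_self, (F.flow t ht).order_zero l hl _ (by omega) _
          (conserved_subMom_compl S hk)]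
        simp
      have hlt : r - σ < r := by
        refine lt_of_le_of_ne tsub_le_self fun h => h0 ?_
        have := tsub_add_cancel_of_le hσr
        rw [h] at this
        exact add_eq_left.1 this
      have hd : ∑ i, r i = ∑ i, σ i + ∑ i, (r - σ) i := by
        rw [← Finset.sum_add_distrib]
        exact Finset.sum_congr rfl fun i _ => (add_tsub_cancel_of_le (hσr i)).symm
      rw [hd]
      exact ((ih σ (lt_of_le_of_ne hσr h1) _ (by omega) l hl _
        (conserved_subMom_neg S k)).const_mul _).mul
        (ih (r - σ) hlt _ (by omega) l hl _ (conserved_subMom_compl S hk))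
    · refine polyOn_integral (fun q => ?_) fun t ht =>
        integrable_loop hK (F.scale_pos hl) (F.abs_le_sq hl)
          ((F.flow t ht).smooth l hl _ r (by omega)) k
      simp only [mul_comm _ (dPropagator K B l q)]
      exact (ih2 l hl _ (conserved_loopMom hk q)).const_mul _
  have hΛ0 := F.scale_pos hΛ
  have hR0 : ∀ l ∈ Set.Icc ΛR Λ0, ∀ (p : ℕ) (a : Fin p → Fin n × Fin n × Fin 4) (k : Fin n → Mom),
      Conserved k →
      momDeriv a (fun y => ∑ u ∈ s, c u * polchinskiRHS K A B l (L u l) n r y) k = 0 := by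
    intro l hl p a k hk
    rw [momDeriv_congr hn (ContDiff.sum fun u hu => contDiff_const.mul (hsmoothR u hu l hl))
      (contDiff_const (c := (0 : ℝ))) (hRzero l hl) a hk, momDeriv, iteratedFDeriv_fun_zero]
    rfl
  -- This ratio makes the ball at scale `Λ` reach the given `k`.
  have key := flow_estimate hn (ρ := ‖k‖ / Λ) (by positivity) (Qb := 0) (Qc := 0)
    (fun _ => IsPln.zero) (fun _ => IsPln.zero) (ΛR := ΛR) (Λ0 := Λ0) (M := 0) F.pos le_rfl
    (G := fun l y => ∑ u ∈ s, c u * L u l n r y)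
    (R := fun l y => ∑ u ∈ s, c u * polchinskiRHS K A B l (L u l) n r y)
    (fun l hl => ContDiff.sum fun u hu => contDiff_const.mul (hsmooth u hu l hl n r hn))
    (fun l hl p a k hk => ?_) (fun l hl p a k hk => ?_) (fun p hp a k hk => ?_) (fun p hp a => ?_)
    0 Λ hΛ Fin.elim0 k ⟨hk, by rw [div_mul_cancel₀ _ hΛ0.ne']⟩
  · simpa [momDeriv] using key
  · rw [momDeriv_sum_mul fun u hu => hsmoothR u hu l hl]
    refine (HasDerivWithinAt.fun_sum fun u hu => ((F.flow u (hs.1 u hu)).rge l hl n r hn p a k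
      hk).const_mul (c u)).congr (fun l' hl' => ?_) ?_
    · exact momDeriv_sum_mul (fun u hu => hsmooth u hu l' hl' n r hn) a k
    · exact momDeriv_sum_mul (fun u hu => hsmooth u hu l hl n r hn) a k
  · rw [hR0 l hl p a k hk.1]; simp
  · have h0 : Λ0 ∈ Set.Icc ΛR Λ0 := Set.right_mem_Icc.2 F.le
    rw [momDeriv_sum_mul fun u hu => hsmooth u hu Λ0 h0 n r hn]
    have hX := hs.2 Polynomial.X (Polynomial.natDegree_X_le.trans hdeg)
    simp only [Polynomial.eval_X] at hX
    have : ∑ u ∈ s, c u * momDeriv a (L u Λ0 n r) k =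
        (∑ u ∈ s, c u * u) * momDeriv a (L 1 Λ0 n r) k := by
      rw [Finset.sum_mul]
      refine Finset.sum_congr rfl fun u hu => ?_
      rw [F.bare_eq (hs.1 u hu) r hn hp a hk.1, mul_assoc]
    rw [this, hX]; simp
  · have h0 : ΛR ∈ Set.Icc ΛR Λ0 := Set.left_mem_Icc.2 F.le
    rw [momDeriv_sum_mul fun u hu => hsmooth u hu ΛR h0 n r hn]
    have h1 := hs.2 1 (by simp)
    simp only [Polynomial.eval_one] at h1
    have : ∑ u ∈ s, c u * momDeriv a (L u ΛR n r) 0 =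
        (∑ u ∈ s, c u * 1) * momDeriv a (L 1 ΛR n r) 0 := by
      rw [Finset.sum_mul]
      refine Finset.sum_congr rfl fun u hu => ?_
      rw [F.ren_eq (hs.1 u hu) (t' := 1) (by simp) r hn hp a, mul_one]
    rw [this, h1, zero_mul]

end Family

/-! ### Suppression of differences -/

section Differences

variable {K : ℝ → ℝ} {N : PertOrder → ℕ} {P P₀ : ℕ → ℕ → PertOrder → Polynomial ℝ}
  {ΛR Λ0 A B : ℝ} {L : ℝ → ℝ → VertexFunctions} {ρ₆ ρ₇ ρ₈ : PertOrder → ℝ}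

theorem IsBoundedFamily.contDiff_ext (F : IsBoundedFamily K N P P₀ ΛR Λ0 A B L ρ₆ ρ₇ ρ₈) {t : ℝ}
    (ht : t ∈ Set.Icc (0 : ℝ) 1) {Λ : ℝ} (hΛ : Λ ∈ Set.Icc ΛR Λ0) (n : ℕ) (r : PertOrder)
    (hn : 1 ≤ n) : ContDiff ℝ ∞ (extVertex (L t Λ) n r) :=
  contDiff_hyperplaneExt ((F.flow t ht).smooth Λ hΛ n r hn)

/-- The boundedness hypothesis in terms of `L` instead of the dimensionless functions. -/
theorem IsBoundedFamily.scaleBound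
    (F : IsBoundedFamily K N P P₀ ΛR Λ0 A B L ρ₆ ρ₇ ρ₈) {t : ℝ}
    (ht : t ∈ Set.Icc (0 : ℝ) 1) {Λ : ℝ} (hΛ : Λ ∈ Set.Icc ΛR Λ0) {n : ℕ} (r : PertOrder)
    (hn : 1 ≤ n) {k : Fin n → Mom} (hk : k ∈ region n Λ) :
    ScaleBound (extVertex (L t Λ) n r) k Λ (orderScale ΛR Λ0 r) (4 - n) (Real.log (Λ0 / ΛR))
      (dilatePoly (4 * n) fun p => P n p r) := by
  intro p
  have hs := (F.flow t ht).smooth Λ hΛ n r hn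
  have hΛ0 := F.scale_pos hΛ
  refine (norm_iteratedFDeriv_hyperplaneExt_le hn hs hk.1 fun a => ?_).trans
    (le_of_eq ?_) (b := (4 * n) ^ p * (orderScale ΛR Λ0 r * Λ ^ (4 - n - p : ℤ) *
      (P n p r).eval (Real.log (Λ0 / ΛR))))
  · have h := F.bound t ht Λ hΛ n p r hn a k hk
    have e : momDeriv a (dimless Λ (L t Λ) n r) k =
        Λ ^ ((n : ℤ) - 4 + (r 0 : ℤ) - (ordNR r : ℤ)) * momDeriv a (L t Λ n r) k :=
      momDeriv_const_mul _ hs a k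
    rw [e, powerBound_eq hΛ0 n, abs_mul, abs_of_pos (zpow_pos hΛ0 _)] at h
    exact le_of_mul_le_mul_left h (zpow_pos hΛ0 _)
  · rw [dilatePoly, Polynomial.eval_mul, Polynomial.eval_C]
    ring

theorem treeTerm_sub (K : ℝ → ℝ) (B Λ : ℝ) {n : ℕ} (S : Finset (Fin n))
    (f f' : (Fin (S.card + 1) → Mom) → ℝ) (g g' : (Fin (Sᶜ.card + 1) → Mom) → ℝ) :
    treeTerm K B Λ S f g - treeTerm K B Λ S f' g' =
      treeTerm K B Λ S (f - f') g + treeTerm K B Λ S f' (g - g') := by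
  funext k
  simp only [treeTerm, Pi.sub_apply, Pi.add_apply]
  ring

theorem loopTerm_sub (hK : IsCutoff K) {B Λ : ℝ} (hΛ : 0 < Λ) (hB : |B| ≤ Λ ^ 2)
    {n : ℕ} {f g : (Fin (n + 2) → Mom) → ℝ} (hf : ContDiff ℝ ∞ f) (hg : ContDiff ℝ ∞ g) :
    loopTerm K B Λ f - loopTerm K B Λ g = loopTerm K B Λ (n := n) (f - g) := by
  funext k
  simp only [loopTerm, Pi.sub_apply, sub_mul]
  exact (MeasureTheory.integral_sub (integrable_loop hK hΛ hB hf k)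
    (integrable_loop hK hΛ hB hg k)).symm

/-- The bound on differences `L t - L t'` at order `r`, for vertices with `n` legs: they are smaller
than the vertex functions themselves by a factor `(Λ / Λ0) ^ 2`. The polynomials are uniform over
all
families. -/
def DifferenceBound (K : ℝ → ℝ) (N : PertOrder → ℕ) (P P₀ : ℕ → ℕ → PertOrder → Polynomial ℝ)
    (r : PertOrder) (n : ℕ) : Prop :=
  ∃ Q : ℕ → Polynomial ℝ, (∀ p, IsPln (Q p)) ∧ ∀ {ΛR Λ0 A B : ℝ} {L : ℝ → ℝ → VertexFunctions}
    {ρ₆ ρ₇ ρ₈ : PertOrder → ℝ}, IsBoundedFamily K N P P₀ ΛR Λ0 A B L ρ₆ ρ₇ ρ₈ →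
    ∀ t ∈ Set.Icc (0 : ℝ) 1, ∀ t' ∈ Set.Icc (0 : ℝ) 1, ∀ Λ ∈ Set.Icc ΛR Λ0, ∀ k ∈ region n Λ,
      ScaleBound (extVertex (L t Λ) n r - extVertex (L t' Λ) n r) k Λ
        (orderScale ΛR Λ0 r * (Λ0 ^ 2)⁻¹) (6 - n) (Real.log (Λ0 / ΛR)) Q

/-- The same bound for the right-hand side of the flow equation. -/
theorem rhs_difference_bound (hK : IsCutoff K) (hP : ∀ n p r, IsPln (P n p r)) {r : PertOrder}
    {n : ℕ} (ih : ∀ s < r, ∀ m, 1 ≤ m → DifferenceBound K N P P₀ s m)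
    (ih2 : DifferenceBound K N P P₀ r (n + 2)) :
    ∃ Q : ℕ → Polynomial ℝ, (∀ p, IsPln (Q p)) ∧ ∀ {ΛR Λ0 A B : ℝ} {L : ℝ → ℝ → VertexFunctions}
    {ρ₆ ρ₇ ρ₈ : PertOrder → ℝ}, IsBoundedFamily K N P P₀ ΛR Λ0 A B L ρ₆ ρ₇ ρ₈ →
    ∀ t ∈ Set.Icc (0 : ℝ) 1, ∀ t' ∈ Set.Icc (0 : ℝ) 1, ∀ Λ ∈ Set.Icc ΛR Λ0, ∀ k ∈ region n Λ,
      ScaleBound (polchinskiRHS K A B Λ (extVertex (L t Λ)) n r -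
          polchinskiRHS K A B Λ (extVertex (L t' Λ)) n r) k Λ
        (orderScale ΛR Λ0 r * (Λ0 ^ 2)⁻¹) (5 - n) (Real.log (Λ0 / ΛR)) Q := by
  have hPd : ∀ n r, ∀ p, IsPln (dilatePoly (4 * (n : ℕ)) (fun p => P n p r) p) := fun n r =>
    isPln_dilatePoly (by positivity) fun p => hP n p r
  -- Tree terms in which one of the factors has order zero vanish, so that all factors have strictly
  -- lower order.
  have tree : ∀ (S : Finset (Fin n)) (s : PertOrder), ∃ Q : ℕ → Polynomial ℝ, (∀ p, IsPln (Q p)) ∧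
      (s ≤ r → ∀ {ΛR Λ0 A B : ℝ} {L : ℝ → ℝ → VertexFunctions} {ρ₆ ρ₇ ρ₈ : PertOrder → ℝ},
      IsBoundedFamily K N P P₀ ΛR Λ0 A B L ρ₆ ρ₇ ρ₈ →
      ∀ t ∈ Set.Icc (0 : ℝ) 1, ∀ t' ∈ Set.Icc (0 : ℝ) 1, ∀ Λ ∈ Set.Icc ΛR Λ0, ∀ k ∈ region n Λ,
        ScaleBound (treeTerm K B Λ S (extVertex (L t Λ) (S.card + 1) s)
            (extVertex (L t Λ) (Sᶜ.card + 1) (r - s)) -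
          treeTerm K B Λ S (extVertex (L t' Λ) (S.card + 1) s)
            (extVertex (L t' Λ) (Sᶜ.card + 1) (r - s))) k Λ
          (orderScale ΛR Λ0 r * (Λ0 ^ 2)⁻¹) (5 - n) (Real.log (Λ0 / ΛR)) Q) := by
    intro S s
    by_cases hsr : s ≤ r
    swap
    · exact ⟨0, fun _ => IsPln.zero, fun h => absurd h hsr⟩
    have hzero : ∀ {ΛR Λ0 A B : ℝ} {L : ℝ → ℝ → VertexFunctions} {ρ₆ ρ₇ ρ₈ : PertOrder → ℝ},
        IsBoundedFamily K N P P₀ ΛR Λ0 A B L ρ₆ ρ₇ ρ₈ → ∀ t ∈ Set.Icc (0 : ℝ) 1,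
        ∀ Λ ∈ Set.Icc ΛR Λ0, ∀ m, extVertex (L t Λ) (m + 1) 0 = 0 := by
      intro ΛR Λ0 A B L ρ₆ ρ₇ ρ₈ F t ht Λ hΛ m
      exact hyperplaneExt_congr (g := 0) (by omega)
        ((F.flow t ht).order_zero Λ hΛ (m + 1) (by omega))
    by_cases h0 : s = 0 ∨ s = r
    · refine ⟨0, fun _ => IsPln.zero, fun _ {ΛR Λ0 A B L ρ₆ ρ₇ ρ₈} F t ht t' ht' Λ hΛ k hk => ?_⟩
      have : treeTerm K B Λ S (extVertex (L t Λ) (S.card + 1) s)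
            (extVertex (L t Λ) (Sᶜ.card + 1) (r - s)) -
          treeTerm K B Λ S (extVertex (L t' Λ) (S.card + 1) s)
            (extVertex (L t' Λ) (Sᶜ.card + 1) (r - s)) = fun _ => 0 := by
        funext k
        rcases h0 with rfl | rfl
        · simp [treeTerm, hzero F t ht Λ hΛ, hzero F t' ht' Λ hΛ]
        · simp [treeTerm, hzero F t ht Λ hΛ, hzero F t' ht' Λ hΛ]
      rw [this]
      have := orderScale_nonneg F.pos F.le r
      exact scaleBound_of_eventuallyEq_zero Filter.EventuallyEq.rfl (F.scale_pos hΛ)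
        (by positivity) F.log_nonneg fun _ => IsPln.zero
    push Not at h0
    have hlt : s < r := lt_of_le_of_ne hsr h0.2
    have hlt' : r - s < r := by
      refine lt_of_le_of_ne tsub_le_self fun h => h0.1 ?_
      have := tsub_add_cancel_of_le hsr
      rw [h] at this
      exact add_eq_left.1 this
    obtain ⟨Q₁, hQ₁, hb₁⟩ := ih s hlt (S.card + 1) (by omega)
    obtain ⟨Q₂, hQ₂, hb₂⟩ := ih (r - s) hlt' (Sᶜ.card + 1) (by omega)
    obtain ⟨R₁, hR₁, hc₁⟩ := scaleBound_treeTerm hK S hQ₁ (hPd (Sᶜ.card + 1) (r - s))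
    obtain ⟨R₂, hR₂, hc₂⟩ := scaleBound_treeTerm hK S (hPd (S.card + 1) s) hQ₂
    refine ⟨fun p => R₁ p + R₂ p, fun p => (hR₁ p).add (hR₂ p),
      fun _ {ΛR Λ0 A B L ρ₆ ρ₇ ρ₈} F t ht t' ht' Λ hΛ k hk => ?_⟩
    have hΛ0 := F.scale_pos hΛ
    have hB := F.abs_le_sq hΛ
    have hM := fun r => orderScale_nonneg F.pos F.le r
    have hMs := hM s
    have hMrs := hM (r - s)
    have s1 := F.contDiff_ext ht hΛ (S.card + 1) s (by omega)
    have s2 := F.contDiff_ext ht' hΛ (S.card + 1) s (by omega)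
    have s3 := F.contDiff_ext ht hΛ (Sᶜ.card + 1) (r - s) (by omega)
    have s4 := F.contDiff_ext ht' hΛ (Sᶜ.card + 1) (r - s) (by omega)
    have hcard : (S.card : ℤ) + Sᶜ.card = n := by
      have := Finset.card_add_card_compl S
      rw [Fintype.card_fin] at this
      exact_mod_cast this
    rw [treeTerm_sub]
    refine ScaleBound.add (contDiff_treeTerm hK hΛ0 hB S (s1.sub s2) s3)
      (contDiff_treeTerm hK hΛ0 hB S s2 (s3.sub s4)) ?_ ?_
    · have h := hc₁ hΛ0 hB (by positivity) (hM _) F.log_nonneg (s1.sub s2) s3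
        (hb₁ F t ht t' ht' Λ hΛ) (fun k hk => F.scaleBound ht hΛ (r - s) (by omega) hk) k hk
      rw [mul_right_comm, orderScale_mul ΛR Λ0 hsr] at h
      have hexp : (6 - (S.card + 1 : ℕ) + (4 - (Sᶜ.card + 1 : ℕ)) - 3 : ℤ) = 5 - n := by
        push_cast
        linarith
      rw [hexp] at h
      exact h
    · have h := hc₂ hΛ0 hB (hM _) (by positivity) F.log_nonneg s2 (s3.sub s4)
        (fun k hk => F.scaleBound ht' hΛ s (by omega) hk) (hb₂ F t ht t' ht' Λ hΛ) k hk
      rw [← mul_assoc, orderScale_mul ΛR Λ0 hsr] at h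
      have hexp : (4 - (S.card + 1 : ℕ) + (6 - (Sᶜ.card + 1 : ℕ)) - 3 : ℤ) = 5 - n := by
        push_cast
        linarith
      rw [hexp] at h
      exact h
  choose QT hQT hT using tree
  obtain ⟨Q₂, hQ₂, hb₂⟩ := ih2
  obtain ⟨R, hR, hc⟩ := scaleBound_loopTerm hK n hQ₂
  refine ⟨fun p => Polynomial.C |(-(1 / 2) : ℝ)| * (∑ S : Finset (Fin n), ∑ s ∈ Finset.Iic r,
      QT S s p) + Polynomial.C |-(1 / 2) * (1 / (2 * Real.pi) ^ 4)| * R p,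
    fun p => ((IsPln.C (abs_nonneg _)).mul (IsPln.sum fun S _ => IsPln.sum fun s _ =>
      hQT S s p)).add ((IsPln.C (abs_nonneg _)).mul (hR p)),
    fun {ΛR Λ0 A B L ρ₆ ρ₇ ρ₈} F t ht t' ht' Λ hΛ k hk => ?_⟩
  have hΛ0 := F.scale_pos hΛ
  have hB := F.abs_le_sq hΛ
  have s1 := F.contDiff_ext ht hΛ (n + 2) r (by omega)
  have s2 := F.contDiff_ext ht' hΛ (n + 2) r (by omega)
  have hsT : ∀ S : Finset (Fin n), ∀ s, ContDiff ℝ ∞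
      (treeTerm K B Λ S (extVertex (L t Λ) (S.card + 1) s)
            (extVertex (L t Λ) (Sᶜ.card + 1) (r - s)) -
          treeTerm K B Λ S (extVertex (L t' Λ) (S.card + 1) s)
            (extVertex (L t' Λ) (Sᶜ.card + 1) (r - s))) := fun S s =>
    (contDiff_treeTerm hK hΛ0 hB S (F.contDiff_ext ht hΛ _ _ (by omega))
      (F.contDiff_ext ht hΛ _ _ (by omega))).sub
    (contDiff_treeTerm hK hΛ0 hB S (F.contDiff_ext ht' hΛ _ _ (by omega))
      (F.contDiff_ext ht' hΛ _ _ (by omega)))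
  have e : polchinskiRHS K A B Λ (extVertex (L t Λ)) n r -
      polchinskiRHS K A B Λ (extVertex (L t' Λ)) n r =
      (fun k => -(1 / 2) * ∑ S : Finset (Fin n), ∑ s ∈ Finset.Iic r,
        (treeTerm K B Λ S (extVertex (L t Λ) (S.card + 1) s)
            (extVertex (L t Λ) (Sᶜ.card + 1) (r - s)) -
          treeTerm K B Λ S (extVertex (L t' Λ) (S.card + 1) s)
            (extVertex (L t' Λ) (Sᶜ.card + 1) (r - s))) k) +
      fun k => -(1 / 2) * (1 / (2 * Real.pi) ^ 4) *
        loopTerm K B Λ (extVertex (L t Λ) (n + 2) r - extVertex (L t' Λ) (n + 2) r) k := by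
    rw [← loopTerm_sub hK hΛ0 hB s1 s2]
    funext k
    simp only [Pi.sub_apply, Pi.add_apply, polchinskiRHS_eq hK A B hΛ0, Finset.sum_sub_distrib]
    ring
  rw [e]
  refine ScaleBound.add (contDiff_const.mul (ContDiff.sum fun S _ => ContDiff.sum fun s _ =>
    hsT S s)) (contDiff_const.mul (contDiff_loopTerm hK hΛ0 hB (s1.sub s2))) ?_ ?_
  · refine ScaleBound.const_mul (ContDiff.sum fun S _ => ContDiff.sum fun s _ => hsT S s) ?_ _
    refine ScaleBound.sum (fun S _ => ContDiff.sum fun s _ => hsT S s) fun S _ => ?_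
    refine ScaleBound.sum (fun s _ => hsT S s) fun s hs => ?_
    exact hT S s (Finset.mem_Iic.1 hs) F t ht t' ht' Λ hΛ k hk
  · refine ScaleBound.const_mul (contDiff_loopTerm hK hΛ0 hB (s1.sub s2)) ?_ _
    have h := hc hΛ0 hB (s1.sub s2) (hb₂ F t ht t' ht' Λ hΛ) k hk
    have hexp : (6 - (n + 2 : ℕ) + 1 : ℤ) = 5 - n := by
      push_cast
      ring
    rw [hexp] at h
    exact h

/-- At the bare scale the linear dependence on `t` turns the bound on the `t`-derivative into a
bound
on differences. -/
theorem IsBoundedFamily.bare_difference (F : IsBoundedFamily K N P P₀ ΛR Λ0 A B L ρ₆ ρ₇ ρ₈) {t t' :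
  ℝ}
    (ht : t ∈ Set.Icc (0 : ℝ) 1) (ht' : t' ∈ Set.Icc (0 : ℝ) 1) {n p : ℕ} (r : PertOrder)
    (hn : 1 ≤ n) (hnp : 6 ≤ n + p) (a : Fin p → Fin n × Fin n × Fin 4) {k : Fin n → Mom}
    (hk : k ∈ region n Λ0) :
    |momDeriv a (L t Λ0 n r) k - momDeriv a (L t' Λ0 n r) k| ≤
      orderScale ΛR Λ0 r * (Λ0 ^ 2)⁻¹ * Λ0 ^ (6 - n - p : ℤ) *
        (P₀ n p r).eval (Real.log (Λ0 / ΛR)) := by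
  have hΛ : Λ0 ∈ Set.Icc ΛR Λ0 := Set.right_mem_Icc.2 F.le
  have hΛ0 := F.scale_pos hΛ
  have h0 : (0 : ℝ) ∈ Set.Icc (0 : ℝ) 1 := by simp
  have hd := F.bare_deriv 0 h0 n p r hn hnp a k hk
  have h1 : derivWithin (fun τ => momDeriv a (dimless Λ0 (L τ Λ0) n r) k) (Set.Icc 0 1) 0 =
      momDeriv a (dimless Λ0 (L 1 Λ0) n r) k := by
    refine HasDerivWithinAt.derivWithin ?_ (uniqueDiffOn_Icc zero_lt_one 0 h0)
    refine (((hasDerivWithinAt_id (0 : ℝ) (Set.Icc 0 1)).mul_const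
      (momDeriv a (dimless Λ0 (L 1 Λ0) n r) k)).congr (fun τ hτ => ?_) ?_).congr_deriv (one_mul _)
    · exact F.bare τ hτ n p r hn hnp a k hk.1
    · exact F.bare 0 h0 n p r hn hnp a k hk.1
  have e : momDeriv a (dimless Λ0 (L 1 Λ0) n r) k =
      Λ0 ^ ((n : ℤ) - 4 + (r 0 : ℤ) - (ordNR r : ℤ)) * momDeriv a (L 1 Λ0 n r) k :=
    momDeriv_const_mul _ ((F.flow 1 (by simp)).smooth Λ0 hΛ n r hn) a k
  have hpb := powerBound_eq (ΛR := ΛR) (Λ0 := Λ0) hΛ0 n p r (P₀ n p r)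
  rw [powerBound, div_self hΛ0.ne', one_pow, mul_one] at hpb
  rw [h1, e, hpb, abs_mul, abs_of_pos (zpow_pos hΛ0 _)] at hd
  have hd' := le_of_mul_le_mul_left hd (zpow_pos hΛ0 _)
  have htt : |t - t'| ≤ 1 := by
    rw [abs_le]; constructor <;> linarith [ht.1, ht.2, ht'.1, ht'.2]
  rw [F.bare_eq ht r hn hnp a hk.1, F.bare_eq ht' r hn hnp a hk.1, ← sub_mul, abs_mul]
  have h4 : (Λ0 ^ 2)⁻¹ * Λ0 ^ (6 - n - p : ℤ) = Λ0 ^ (4 - n - p : ℤ) := by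
    rw [← zpow_natCast, ← zpow_neg, ← zpow_add₀ hΛ0.ne']
    congr 1; push_cast; ring
  rw [mul_assoc (orderScale _ _ _), h4]
  exact (mul_le_of_le_one_left (abs_nonneg _) htt).trans hd'

/-- Differences are suppressed at every order: the flow transports the bounds at the bare scale and
the vanishing at the renormalization scale to all scales. -/
theorem differenceBound (hK : IsCutoff K) (hP : ∀ n p r, IsPln (P n p r))
    (hP₀ : ∀ n p r, IsPln (P₀ n p r)) (r : PertOrder) :
    ∀ n, 1 ≤ n → DifferenceBound K N P P₀ r n := by
  have vanish : ∀ (r : PertOrder) (n : ℕ), (∀ {ΛR Λ0 A B : ℝ} {L : ℝ → ℝ → VertexFunctions}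
      {ρ₆ ρ₇ ρ₈ : PertOrder → ℝ}, IsBoundedFamily K N P P₀ ΛR Λ0 A B L ρ₆ ρ₇ ρ₈ →
      ∀ t ∈ Set.Icc (0 : ℝ) 1, ∀ Λ ∈ Set.Icc ΛR Λ0, ∀ k, Conserved k → L t Λ n r k = 0) →
      1 ≤ n → DifferenceBound K N P P₀ r n := by
    intro r n h hn
    refine ⟨0, fun _ => IsPln.zero, fun {ΛR Λ0 A B L ρ₆ ρ₇ ρ₈} F t ht t' ht' Λ hΛ k hk => ?_⟩
    have e : ∀ t ∈ Set.Icc (0 : ℝ) 1, extVertex (L t Λ) n r = 0 := fun t ht =>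
      hyperplaneExt_congr (g := 0) hn (h F t ht Λ hΛ)
    rw [e t ht, e t' ht', sub_zero]
    have := orderScale_nonneg F.pos F.le r
    exact scaleBound_of_eventuallyEq_zero Filter.EventuallyEq.rfl (F.scale_pos hΛ)
      (by positivity) F.log_nonneg fun _ => IsPln.zero
  refine order_induction (N := N) (fun n hn => vanish 0 n (fun F t ht Λ hΛ =>
    (F.flow t ht).order_zero Λ hΛ n hn) hn) (fun r n hn hN => vanish r n (fun F t ht Λ hΛ =>
    (F.flow t ht).finite_order Λ hΛ n r hn hN) hn) ?_ r
  intro r n hn _ ih ih2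
  obtain ⟨Q, hQ, hb⟩ := rhs_difference_bound hK hP ih ih2
  have hQc : ∀ p, IsPln (dilatePoly 2 Q p) := isPln_dilatePoly zero_le_two hQ
  have hQb : ∀ p, IsPln (P₀ n p r) := fun p => hP₀ n p r
  refine ⟨dilatePoly (4 * n) (flowPoly n 2 (fun p => P₀ n p r) (dilatePoly 2 Q)),
    isPln_dilatePoly (by positivity) (isPln_flowPoly zero_le_two hQb hQc),
    fun {ΛR Λ0 A B L ρ₆ ρ₇ ρ₈} F t ht t' ht' Λ hΛ k hk p => ?_⟩
  have hM := orderScale_nonneg F.pos F.le r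
  have hs := fun t ht Λ hΛ => (F.flow t ht).smooth Λ hΛ n r hn
  have hsR : ∀ t ∈ Set.Icc (0 : ℝ) 1, ∀ Λ ∈ Set.Icc ΛR Λ0,
      ContDiff ℝ ∞ (polchinskiRHS K A B Λ (extVertex (L t Λ)) n r) := fun t ht Λ hΛ =>
    contDiff_polchinskiRHS hK A (F.scale_pos hΛ) (F.abs_le_sq hΛ) (F.contDiff_ext ht hΛ) n r
  have hsR' : ∀ t ∈ Set.Icc (0 : ℝ) 1, ∀ Λ ∈ Set.Icc ΛR Λ0,
      ContDiff ℝ ∞ (polchinskiRHS K A B Λ (L t Λ) n r) := fun t ht Λ hΛ =>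
    contDiff_polchinskiRHS hK A (F.scale_pos hΛ) (F.abs_le_sq hΛ) ((F.flow t ht).smooth Λ hΛ) n r
  have hext : ∀ t ∈ Set.Icc (0 : ℝ) 1, ∀ Λ ∈ Set.Icc ΛR Λ0, ∀ (p : ℕ)
      (a : Fin p → Fin n × Fin n × Fin 4) (k : Fin n → Mom), Conserved k →
      momDeriv a (polchinskiRHS K A B Λ (L t Λ) n r) k =
        momDeriv a (polchinskiRHS K A B Λ (extVertex (L t Λ)) n r) k :=
    fun t ht Λ hΛ p a k hk => momDeriv_congr hn (hsR' t ht Λ hΛ) (hsR t ht Λ hΛ)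
      (fun k hk => (polchinskiRHS_extVertex hK A B (F.scale_pos hΛ) (L t Λ) n r hk).symm) a hk
  have key := flow_estimate hn (ρ := 2) zero_le_two hQc hQb (ΛR := ΛR) (Λ0 := Λ0)
    (M := orderScale ΛR Λ0 r * (Λ0 ^ 2)⁻¹) F.pos (by positivity)
    (G := fun l => L t l n r - L t' l n r)
    (R := fun l => polchinskiRHS K A B l (extVertex (L t l)) n r -
      polchinskiRHS K A B l (extVertex (L t' l)) n r)
    (fun l hl => (hs t ht l hl).sub (hs t' ht' l hl)) (fun l hl p a k hk => ?_)
    (fun l hl p a k hk => ?_) (fun p hp a k hk => ?_) (fun p hp a => ?_) p Λ hΛ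
  · have hk' := hk
    rw [region_eq_momBall (F.scale_pos hΛ)] at hk'
    refine (norm_iteratedFDeriv_hyperplaneExt_le hn ((hs t ht Λ hΛ).sub (hs t' ht' Λ hΛ)) hk.1
      fun a => key a k hk').trans (le_of_eq ?_)
    rw [dilatePoly, Polynomial.eval_mul, Polynomial.eval_C]
    ring
  · rw [momDeriv_sub (hsR t ht l hl) (hsR t' ht' l hl), ← hext t ht l hl p a k hk,
      ← hext t' ht' l hl p a k hk]
    refine (((F.flow t ht).rge l hl n r hn p a k hk).sub
      ((F.flow t' ht').rge l hl n r hn p a k hk)).congr (fun l' hl' => ?_) ?_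
    · exact momDeriv_sub (hs t ht l' hl') (hs t' ht' l' hl') a k
    · exact momDeriv_sub (hs t ht l hl) (hs t' ht' l hl) a k
  · rw [← region_eq_momBall (F.scale_pos hl)] at hk
    refine (abs_momDeriv_le a _ k).trans ?_
    rw [dilatePoly, Polynomial.eval_mul, Polynomial.eval_C, mul_left_comm]
    gcongr
    exact hb F t ht t' ht' l hl k hk p
  · rw [← region_eq_momBall (F.pos.trans_le F.le)] at hk
    have h0 : Λ0 ∈ Set.Icc ΛR Λ0 := Set.right_mem_Icc.2 F.le
    rw [momDeriv_sub (hs t ht Λ0 h0) (hs t' ht' Λ0 h0)]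
    exact F.bare_difference ht ht' r hn hp a hk
  · have h0 : ΛR ∈ Set.Icc ΛR Λ0 := Set.left_mem_Icc.2 F.le
    rw [momDeriv_sub (hs t ht ΛR h0) (hs t' ht' ΛR h0), F.ren_eq ht ht' r hn hp a, sub_self]

/-- The differences of the dimensionless vertex functions. -/
theorem dimless_difference_bound (hK : IsCutoff K) (hP : ∀ n p r, IsPln (P n p r))
    (hP₀ : ∀ n p r, IsPln (P₀ n p r)) (r : PertOrder) {n : ℕ} (hn : 1 ≤ n) :
    ∃ Q : ℕ → Polynomial ℝ, (∀ p, IsPln (Q p)) ∧ ∀ {ΛR Λ0 A B : ℝ} {L : ℝ → ℝ → VertexFunctions}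
    {ρ₆ ρ₇ ρ₈ : PertOrder → ℝ}, IsBoundedFamily K N P P₀ ΛR Λ0 A B L ρ₆ ρ₇ ρ₈ →
    ∀ t ∈ Set.Icc (0 : ℝ) 1, ∀ t' ∈ Set.Icc (0 : ℝ) 1, ∀ Λ ∈ Set.Icc ΛR Λ0, ∀ (p : ℕ)
      (a : Fin p → Fin n × Fin n × Fin 4), ∀ k ∈ region n Λ,
      |momDeriv a (dimless Λ (L t Λ) n r) k - momDeriv a (dimless Λ (L t' Λ) n r) k| ≤
        powerBound ΛR Λ0 Λ p r (Q p) * (Λ / Λ0) ^ 2 := by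
  obtain ⟨Q, hQ, hb⟩ := differenceBound (N := N) hK hP hP₀ r n hn
  refine ⟨dilatePoly 2 Q, isPln_dilatePoly zero_le_two hQ,
    fun {ΛR Λ0 A B L ρ₆ ρ₇ ρ₈} F t ht t' ht' Λ hΛ p a k hk => ?_⟩
  have hΛ0 := F.scale_pos hΛ
  have hs := fun t ht => (F.flow t ht).smooth Λ hΛ n r hn
  have e : ∀ t ∈ Set.Icc (0 : ℝ) 1, momDeriv a (dimless Λ (L t Λ) n r) k =
      Λ ^ ((n : ℤ) - 4 + (r 0 : ℤ) - (ordNR r : ℤ)) * momDeriv a (L t Λ n r) k :=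
    fun t ht => momDeriv_const_mul _ (hs t ht) a k
  rw [e t ht, e t' ht', ← mul_sub, abs_mul, abs_of_pos (zpow_pos hΛ0 _), powerBound_eq hΛ0 n]
  have h := (abs_momDeriv_le a (extVertex (L t Λ) n r - extVertex (L t' Λ) n r) k).trans
    (mul_le_mul_of_nonneg_left (hb F t ht t' ht' Λ hΛ k hk p) (by positivity))
  rw [momDeriv_sub (F.contDiff_ext ht hΛ n r hn) (F.contDiff_ext ht' hΛ n r hn), extVertex,
    extVertex,
    momDeriv_hyperplaneExt (hs t ht) a hk.1, momDeriv_hyperplaneExt (hs t' ht') a hk.1] at h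
  have h6 : Λ ^ (6 - n - p : ℤ) = Λ ^ (4 - n - p : ℤ) * Λ ^ 2 := by
    rw [← zpow_natCast, ← zpow_add₀ hΛ0.ne']
    congr 1; push_cast; ring
  rw [mul_assoc]
  refine mul_le_mul_of_nonneg_left (h.trans (le_of_eq ?_)) (zpow_pos hΛ0 _).le
  rw [h6, dilatePoly, Polynomial.eval_mul, Polynomial.eval_C, div_pow]
  ring

end Differences

end PolchinskiFlow

end

open PolchinskiFlow
theorem mainTheorem1 (K : ℝ → ℝ) (hK : IsCutoff K) (N : PertOrder → ℕ)
    (P P₀ : ℕ → ℕ → PertOrder → Polynomial ℝ)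
    (hP : ∀ n p r, IsPln (P n p r)) (hP₀ : ∀ n p r, IsPln (P₀ n p r)) :
    ∃ Q : ℕ → ℕ → PertOrder → Polynomial ℝ, (∀ n p r, IsPln (Q n p r)) ∧
      ∀ (ΛR Λ0 A B : ℝ), 0 < ΛR → ΛR ≤ Λ0 → |A| ≤ ΛR ^ 3 → |B| ≤ ΛR ^ 2 →
      -- a family of flows, indexed by the parameter `t`; `L t Λ n r` is `Lₙ^{(r)}(Λ, Λ0, t)`
      ∀ (L : ℝ → ℝ → VertexFunctions) (ρ₆ ρ₇ ρ₈ : PertOrder → ℝ),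
      (∀ t ∈ Set.Icc (0 : ℝ) 1, IsFlow K N A B ΛR Λ0 (L t)) →
      (∀ t ∈ Set.Icc (0 : ℝ) 1, RenormalizationConditions (L t ΛR)) →
      (∀ t ∈ Set.Icc (0 : ℝ) 1, ImprovementConditions ρ₆ ρ₇ ρ₈ (L t ΛR)) →
      -- the bare vertex functions with `n + p ≥ 6` are rescaled by `t`
      (∀ t ∈ Set.Icc (0 : ℝ) 1, ∀ (n p : ℕ) (r : PertOrder), 1 ≤ n → 6 ≤ n + p →
        ∀ (a : Fin p → Fin n × Fin n × Fin 4) (k : Fin n → Mom), Conserved k →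
          momDeriv a (dimless Λ0 (L t Λ0) n r) k =
            t * momDeriv a (dimless Λ0 (L 1 Λ0) n r) k) →
      -- boundedness of the running vertex functions
      (∀ t ∈ Set.Icc (0 : ℝ) 1, ∀ Λ ∈ Set.Icc ΛR Λ0, ∀ (n p : ℕ) (r : PertOrder), 1 ≤ n →
        ∀ (a : Fin p → Fin n × Fin n × Fin 4), ∀ k ∈ region n Λ,
          |momDeriv a (dimless Λ (L t Λ) n r) k| ≤ powerBound ΛR Λ0 Λ p r (P n p r)) →
      -- bounds for the `t`-derivatives at the bare scale for `n + p ≥ 6`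
      (∀ t ∈ Set.Icc (0 : ℝ) 1, ∀ (n p : ℕ) (r : PertOrder), 1 ≤ n → 6 ≤ n + p →
        ∀ (a : Fin p → Fin n × Fin n × Fin 4), ∀ k ∈ region n Λ0,
          |derivWithin (fun τ => momDeriv a (dimless Λ0 (L τ Λ0) n r) k) (Set.Icc 0 1) t| ≤
            (Λ0 ^ p)⁻¹ * (Λ0 / ΛR) ^ (r 0) * (P₀ n p r).eval (Real.log (Λ0 / ΛR))) →
      ∀ Λ ∈ Set.Icc ΛR Λ0, ∀ (n p : ℕ) (r : PertOrder), 1 ≤ n →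
        ∀ (a : Fin p → Fin n × Fin n × Fin 4), ∀ k ∈ region n Λ,
          -- the `t`-derivatives of the running vertex functions exist and are suppressed
          (∀ t ∈ Set.Icc (0 : ℝ) 1, ∃ D : ℝ,
            HasDerivWithinAt (fun τ => momDeriv a (dimless Λ (L τ Λ) n r) k) D (Set.Icc 0 1) t ∧
            |D| ≤ powerBound ΛR Λ0 Λ p r (Q n p r) * (Λ / Λ0) ^ 2) ∧
          -- accuracy to which the running vertex functions are known
          |momDeriv a (dimless Λ (L 1 Λ) n r) k - momDeriv a (dimless Λ (L 0 Λ) n r) k| ≤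
            powerBound ΛR Λ0 Λ p r (Q n p r) * (Λ / Λ0) ^ 2 := by
  have hdiff : ∀ (n : ℕ) (r : PertOrder), ∃ Q : ℕ → Polynomial ℝ, (∀ p, IsPln (Q p)) ∧
      (1 ≤ n → ∀ {ΛR Λ0 A B : ℝ} {L : ℝ → ℝ → VertexFunctions}
      {ρ₆ ρ₇ ρ₈ : PertOrder → ℝ}, IsBoundedFamily K N P P₀ ΛR Λ0 A B L ρ₆ ρ₇ ρ₈ →
      ∀ t ∈ Set.Icc (0 : ℝ) 1, ∀ t' ∈ Set.Icc (0 : ℝ) 1, ∀ Λ ∈ Set.Icc ΛR Λ0, ∀ (p : ℕ)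
        (a : Fin p → Fin n × Fin n × Fin 4), ∀ k ∈ region n Λ,
        |momDeriv a (dimless Λ (L t Λ) n r) k - momDeriv a (dimless Λ (L t' Λ) n r) k| ≤
          powerBound ΛR Λ0 Λ p r (Q p) * (Λ / Λ0) ^ 2) := by
    intro n r
    by_cases hn : 1 ≤ n
    · obtain ⟨Q, hQ, h⟩ := dimless_difference_bound (N := N) hK hP hP₀ r hn
      exact ⟨Q, hQ, fun _ => h⟩
    · exact ⟨0, fun _ => IsPln.zero, fun h => absurd h hn⟩
  choose Q hQ hb using hdiff
  choose C hC0 hC using exists_derivative_bound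
  -- The summand `1` serves the bound on the difference, `C` the bound on the derivative.
  refine ⟨fun n p r => Polynomial.C (1 + C (∑ i, r i)) * Q n r p,
    fun n p r => (IsPln.C (by linarith [hC0 (∑ i, r i)])).mul (hQ n r p), ?_⟩
  intro ΛR Λ0 A B hR h0 _ hB L ρ₆ ρ₇ ρ₈ hflow hren himp hbare hbound hderiv Λ hΛ n p r hn a k hk
  have F : IsBoundedFamily K N P P₀ ΛR Λ0 A B L ρ₆ ρ₇ ρ₈ :=
    ⟨hR, h0, hB, hflow, hren, himp, hbare, hbound, hderiv⟩
  have hΛ0 := F.scale_pos hΛ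
  have hs := fun t ht => (F.flow t ht).smooth Λ hΛ n r hn
  have e : powerBound ΛR Λ0 Λ p r (Polynomial.C (1 + C (∑ i, r i)) * Q n r p) * (Λ / Λ0) ^ 2 =
      (1 + C (∑ i, r i)) * (powerBound ΛR Λ0 Λ p r (Q n r p) * (Λ / Λ0) ^ 2) := by
    rw [powerBound, powerBound, Polynomial.eval_mul, Polynomial.eval_C]; ring
  have hosc := fun t ht t' ht' => hb n r hn F t ht t' ht' Λ hΛ p a k hk
  have hpos : 0 ≤ powerBound ΛR Λ0 Λ p r (Q n r p) * (Λ / Λ0) ^ 2 :=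
    (abs_nonneg _).trans (hosc 0 (by simp) 0 (by simp))
  -- Linear relations between the vertex functions at different `t` are inherited by derivatives.
  have hpoly : PolyOn (∑ i, r i) fun t => momDeriv a (dimless Λ (L t Λ) n r) k := by
    refine polyOn_of_annihilates fun s c hsc => ?_
    have hs' : ∀ u ∈ s, ContDiff ℝ ∞ (dimless Λ (L u Λ) n r) := fun u hu =>
      contDiff_const.mul (hs u (hsc.1 u hu))
    rw [← momDeriv_sum_mul hs', momDeriv_congr hn (g := fun _ => 0)
      (ContDiff.sum fun u hu => contDiff_const.mul (hs' u hu)) contDiff_const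
      (fun k hk => hsc.sum_eq_zero (f := fun u => dimless Λ (L u Λ) n r k)
        ((F.polyOn hK r n hn Λ hΛ k hk).const_mul _)) a hk.1, momDeriv, iteratedFDeriv_fun_zero]
    rfl
  obtain ⟨R, hRdeg, hReq⟩ := hpoly
  rw [e]
  refine ⟨fun t ht => ⟨R.derivative.eval t, ?_, ?_⟩, ?_⟩
  · exact (R.hasDerivAt t).hasDerivWithinAt.congr hReq (hReq t ht)
  · refine (hC _ R _ hRdeg (fun t ht t' ht' => ?_) t ht).trans
      (mul_le_mul_of_nonneg_right (by linarith) hpos)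
    rw [← hReq t ht, ← hReq t' ht']
    exact hosc t ht t' ht'
  · refine (hosc 1 (by simp) 0 (by simp)).trans (le_mul_of_one_le_left hpos ?_)
    linarith [hC0 (∑ i, r i)]
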